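/- Let $H$ and $Y$ be real Hilbert spaces, $X\subseteq H$ and $K\subseteq Y$ nonempty closed convex sets, $f:X\to\mathbb R\cup\{+\infty\}$ a closed proper convex function and $C:X\to Y$ a map such that $\mathcal C=\{(x,s)\in X\times Y : s\in C(x)-K\}$ is closed and convex. Consider the (possibly infeasible) problem $\inf\{f(x) : x\in X,\ C(x)\in K\}$. Let $\nu(s)=\inf\{f(x): x\in X,\ C(x)\in K+s\}$ be its value function (with $\inf\emptyset=+\infty$), assume that $\nu(s)>-\infty$ for all $s\in Y$, and let $\bar s$ be the element of smallest norm of the closure of $\mathcal S=\{s\in Y : \exists x,\ (x,s)\in\mathcal C\}$. Suppose that $X$ and $K$ are polyhedral (intersections of finitely many closed half-spaces), that $C$ is polyhedral ($X$ is covered by finitely many polyhedral sets on each of which $C$ agrees with a continuous affine map $H\to Y$), and that $f$ is Lipschitz continuous on $X$. Then: 1. $\nu$ is Lipschitz continuous on its domain $\{s : \nu(s)<+\infty\}$. 2. $\nu$ is subdifferentiable at $\bar s$: $\nu(\bar s)$ is finite and there is $\lambda\in Y$ with $\nu(s)\ge\nu(\bar s)+\langle\lambda,s-\bar s\rangle$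 for all $s\in Y$. 3. The inexact augmented Lagrangian method (IALM) converges quantitatively to the closest feasible problem, in the following sense. Let $\gamma_k>0$ $(k\ge 0)$ and $\varepsilon_k\ge 0$ $(k\ge1)$ satisfy (A1) $\sum_{k\ge1}\varepsilon_k<\infty$; (A2) $\frac{\varepsilon_{k+1}}{\gamma_k}\sum_{i=0}^k\gamma_i=O\big(1/\sqrt{\sum_{i=0}^k\gamma_i}\big)$; (A3) $\sum_{k\ge1}(\varepsilon_k/\gamma_k)^2\sum_{i=0}^{k-1}\gamma_i<\infty$; (A4) $\sum_{k\ge1}(\varepsilon_k/\gamma_k)\sum_{i=1}^{k}\gamma_{i-1}<\infty$; (A5) $\sum_{k\ge0}\gamma_k=\infty$. Let $(x^k,y^k,\lambda^k,s^k)$ be generated by IALM, that is, $\lambda^0\in Y$ and for all $k\ge0$: $x^{k+1}\in X$, $y^{k+1}\in K$, $s^{k+1}=C(x^{k+1})-y^{k+1}$, $$L_{\gamma_k}(x^{k+1},s^{k+1},\lambda^k)\le\inf_{(x,s)\in\mathcal C}L_{\gamma_k}(x,s,\lambda^k)+\frac{\varepsilon_{k+1}^2}{2\gamma_k},\qquad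 \lambda^{k+1}=\lambda^k-\gamma_k s^{k+1},$$ where $L_\gamma(x,s,\lambda)=f(x)+\delta_{\mathcal C}(x,s)-\langle\lambda,s\rangle+\frac\gamma2\|s\|^2$ and $\delta_{\mathcal C}$ is the indicator function of $\mathcal C$ ($0$ on $\mathcal C$, $+\infty$ elsewhere). Then $f(x^k)\to\nu(\bar s)$, $C(x^k)-y^k\to\bar s$, $\|y^k-\mathrm{Proj}_K(C(x^k))\|\to0$, and the three quantities $$|f(x^k)-\nu(\bar s)|,\qquad \|C(x^k)-y^k-\bar s\|,\qquad \|y^k-\mathrm{Proj}_K(C(x^k))\|$$ are each $O\big(1/\sqrt{\sum_{i=0}^{k-1}\gamma_i}\big)$ as $k\to\infty$. -/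

import Mathlib

open Filter Topology Asymptotics

noncomputable section

/-! ### Polyhedral sets and maps, Lipschitz extended-real functions, projections -/

/-- A polyhedral set: an intersection of finitely many closed half-spaces. -/
def IsPolyhedralSet {E : Type*} [NormedAddCommGroup E] [InnerProductSpace ℝ E]
    (P : Set E) : Prop :=
  ∃ (n : ℕ) (a : Fin n → E) (c : Fin n → ℝ), P = {x | ∀ i, inner ℝ (a i) x ≤ c i}

/-- A polyhedral (piecewise affine) map on `X`: the set `X` is covered by finitely many polyhedral
sets, on each of which the map agrees with a continuous affine map.  Between finite-dimensional
spaces, for polyhedral `X`, this says that the graph of `C` over `X` is a finite union of convex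
polyhedra.  Every continuous affine map is polyhedral (one piece). -/
def IsPolyhedralMapOn {H Y : Type*} [NormedAddCommGroup H] [InnerProductSpace ℝ H]
    [NormedAddCommGroup Y] [InnerProductSpace ℝ Y] (C : H → Y) (X : Set H) : Prop :=
  ∃ (n : ℕ) (P : Fin n → Set H) (A : Fin n → (H →ᴬ[ℝ] Y)),
    X ⊆ ⋃ i, P i ∧ (∀ i, IsPolyhedralSet (P i)) ∧ ∀ i, ∀ x ∈ X ∩ P i, C x = A i x

/-- Lipschitz continuity on `A` of an extended-real valued function.  If `g` never takes the value
`-∞` on `A` and is finite somewhere on `A`, this forces `g` to be real valued on `A` and Lipschitz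
there in the usual sense. -/
def ELipschitzOn {E : Type*} [NormedAddCommGroup E] (g : E → EReal) (A : Set E) : Prop :=
  ∃ L : ℝ, 0 ≤ L ∧ ∀ x ∈ A, ∀ x' ∈ A, g x ≤ g x' + ((L * ‖x - x'‖ : ℝ) : EReal)

/-- `p` is a point of `A` closest to `z`. -/
def IsNearestPoint {E : Type*} [NormedAddCommGroup E] (A : Set E) (z p : E) : Prop :=
  p ∈ A ∧ ∀ q ∈ A, ‖z - p‖ ≤ ‖z - q‖

/-- A point of `A` closest to `z`; for `A` nonempty, closed and convex in a Hilbert space this is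
the unique metric projection of `z` onto `A`, see `existsUnique_isNearestPoint`. -/
def proj {E : Type*} [NormedAddCommGroup E] (A : Set E) (z : E) : E :=
  Classical.epsilon (IsNearestPoint A z)

theorem existsUnique_isNearestPoint {E : Type*} [NormedAddCommGroup E] [InnerProductSpace ℝ E]
    [CompleteSpace E] {A : Set E} (hne : A.Nonempty) (hcl : IsClosed A) (hc : Convex ℝ A) (z : E) :
    ∃! p, IsNearestPoint A z p := by
  have key : ∀ p ∈ A, (IsNearestPoint A z p ↔ ∀ w ∈ A, inner ℝ (z - p) (w - p) ≤ 0) := by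
    intro p hp
    have : Nonempty A := hne.to_subtype
    have hb : BddBelow (Set.range fun w : A => ‖z - (w : E)‖) :=
      ⟨0, Set.forall_mem_range.2 fun _ => norm_nonneg _⟩
    rw [← norm_eq_iInf_iff_real_inner_le_zero hc hp]
    constructor
    · intro h
      exact le_antisymm (le_ciInf fun w => h.2 w w.2) (ciInf_le hb ⟨p, hp⟩)
    · intro h
      exact ⟨hp, fun q hq => h.le.trans (ciInf_le hb ⟨q, hq⟩)⟩
  obtain ⟨p, hp, hpe⟩ := exists_norm_eq_iInf_of_complete_convex hne hcl.isComplete hc z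
  have hp' : IsNearestPoint A z p :=
    (key p hp).2 ((norm_eq_iInf_iff_real_inner_le_zero hc hp).1 hpe)
  refine ⟨p, hp', fun q hq => ?_⟩
  have h1 := (key p hp).1 hp' q hq.1
  have h2 := (key q hq.1).1 hq p hp
  have h3 : inner ℝ (q - p) (q - p) ≤ (0 : ℝ) := by
    have e : (inner ℝ (q - p) (q - p) : ℝ)
        = inner ℝ (z - p) (q - p) + inner ℝ (z - q) (p - q) := by
      rw [← neg_sub q p, inner_neg_right, ← sub_eq_add_neg, ← inner_sub_left]
      congr 1
      abel
    linarith
  exact sub_eq_zero.1 (inner_self_eq_zero (𝕜 := ℝ).1 (le_antisymm h3 real_inner_self_nonneg))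

theorem isNearestPoint_proj {E : Type*} [NormedAddCommGroup E] [InnerProductSpace ℝ E]
    [CompleteSpace E] {A : Set E} (hne : A.Nonempty) (hcl : IsClosed A) (hc : Convex ℝ A) (z : E) :
    IsNearestPoint A z (proj A z) :=
  Classical.epsilon_spec (existsUnique_isNearestPoint hne hcl hc z).exists

/-! ### The convex problem `inf {f x | x ∈ X, C x ∈ K}` -/

/-- The data of the problem `inf {f x | x ∈ X, C x ∈ K}`.  Only the restrictions of `f` and `C`
to `X` matter. -/
structure ConvexProgram (H Y : Type*) where
  X : Set H
  K : Set Y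
  f : H → EReal
  C : H → Y

namespace ConvexProgram

/-- The graph of `C - K`: pairs `(x, s)` with `x ∈ X` and `s ∈ C x - K`. -/
def CC {H Y : Type*} [NormedAddCommGroup H] [NormedAddCommGroup Y] (P : ConvexProgram H Y) :
    Set (H × Y) :=
  {p | p.1 ∈ P.X ∧ ∃ y ∈ P.K, p.2 = P.C p.1 - y}

/-- The attainable constraint violations. -/
def violations {H Y : Type*} [NormedAddCommGroup H] [NormedAddCommGroup Y]
    (P : ConvexProgram H Y) : Set Y :=
  {s | ∃ x, (x, s) ∈ P.CC}

/-- The smallest-norm element of the closure of the set of attainable violations. -/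
def sBar {H Y : Type*} [NormedAddCommGroup H] [NormedAddCommGroup Y]
    (P : ConvexProgram H Y) : Y :=
  proj (closure P.violations) 0

/-- The value function: the optimal value of the problem with `K` shifted by `s`
(`⊤` if the shifted problem is infeasible). -/
def value {H Y : Type*} [NormedAddCommGroup H] [NormedAddCommGroup Y]
    (P : ConvexProgram H Y) (s : Y) : EReal :=
  ⨅ (x : H) (_ : (x, s) ∈ P.CC), P.f x

/-- The domain of the value function. -/
def valueDom {H Y : Type*} [NormedAddCommGroup H] [NormedAddCommGroup Y]
    (P : ConvexProgram H Y) : Set Y :=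
  {s | P.value s < ⊤}

/-- The epigraph of the restriction of `f` to `X`. -/
def epi {H Y : Type*} (P : ConvexProgram H Y) : Set (H × ℝ) :=
  {p | p.1 ∈ P.X ∧ P.f p.1 ≤ (p.2 : EReal)}

/-- Standing assumptions: `X` and `K` are nonempty, closed and convex; `f` is a proper, closed,
convex function on `X` with values in `ℝ ∪ {+∞}`; the graph of `C - K` is closed and convex (it is
nonempty because `X` and `K` are); the value function never takes the value `-∞`. -/
structure Standing {H Y : Type*} [NormedAddCommGroup H] [InnerProductSpace ℝ H]
    [NormedAddCommGroup Y] [InnerProductSpace ℝ Y] (P : ConvexProgram H Y) : Prop where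
  X_nonempty : P.X.Nonempty
  X_closed : IsClosed P.X
  X_convex : Convex ℝ P.X
  K_nonempty : P.K.Nonempty
  K_closed : IsClosed P.K
  K_convex : Convex ℝ P.K
  f_ne_bot : ∀ x ∈ P.X, P.f x ≠ ⊥
  f_proper : ∃ x ∈ P.X, P.f x ≠ ⊤
  f_closed : IsClosed P.epi
  f_convex : Convex ℝ P.epi
  CC_closed : IsClosed P.CC
  CC_convex : Convex ℝ P.CC
  value_ne_bot : ∀ s, P.value s ≠ ⊥

/-- The value function is finite at `s` and has a subgradient there. -/
def ValueSubdifferentiableAt {H Y : Type*} [NormedAddCommGroup H] [NormedAddCommGroup Y]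
    [InnerProductSpace ℝ Y] (P : ConvexProgram H Y) (s : Y) : Prop :=
  P.value s ≠ ⊤ ∧ P.value s ≠ ⊥ ∧
    ∃ l : Y, ∀ t : Y, P.value s + ((inner ℝ l (t - s) : ℝ) : EReal) ≤ P.value t

/-! ### The inexact augmented Lagrangian method -/

open Classical in
/-- The augmented Lagrangian
`f x + δ_CC (x, s) - ⟪l, s⟫ + (g / 2) ‖s‖ ^ 2` with penalty parameter `g`. -/
def augLagrangian {H Y : Type*} [NormedAddCommGroup H] [NormedAddCommGroup Y]
    [InnerProductSpace ℝ Y] (P : ConvexProgram H Y) (g : ℝ) (x : H) (s l : Y) : EReal :=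
  P.f x + (if (x, s) ∈ P.CC then 0 else ⊤) + ((-inner ℝ l s + g / 2 * ‖s‖ ^ 2 : ℝ) : EReal)

/-- `(x, y, l, s)` is generated by the inexact augmented Lagrangian method with penalty parameters
`γ` and errors `ε`.  The iterates `x`, `y`, `s` start at index `1`, the multipliers `l` at `0`. -/
structure IsIALM {H Y : Type*} [NormedAddCommGroup H] [NormedAddCommGroup Y]
    [InnerProductSpace ℝ Y] (P : ConvexProgram H Y) (γ ε : ℕ → ℝ)
    (x : ℕ → H) (y l s : ℕ → Y) : Prop where
  x_mem : ∀ k, x (k + 1) ∈ P.X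
  y_mem : ∀ k, y (k + 1) ∈ P.K
  s_eq : ∀ k, s (k + 1) = P.C (x (k + 1)) - y (k + 1)
  approx_min : ∀ k, P.augLagrangian (γ k) (x (k + 1)) (s (k + 1)) (l k) ≤
    (⨅ p ∈ P.CC, P.augLagrangian (γ k) p.1 p.2 (l k)) +
      ((ε (k + 1) ^ 2 / (2 * γ k) : ℝ) : EReal)
  l_succ : ∀ k, l (k + 1) = l k - γ k • s (k + 1)

/-- The assumptions on the penalty parameters `γ 0, γ 1, …` and the errors `ε 1, ε 2, …`. -/
structure StepErrorAssumption (γ ε : ℕ → ℝ) : Prop where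
  step_pos : ∀ k, 0 < γ k
  err_nonneg : ∀ k, 0 ≤ ε (k + 1)
  A1 : Summable fun k => ε (k + 1)
  A2 : (fun k => ε (k + 1) / γ k * ∑ i ∈ Finset.range (k + 1), γ i) =O[atTop]
    fun k => 1 / √(∑ i ∈ Finset.range (k + 1), γ i)
  A3 : Summable fun k => (ε (k + 1) / γ (k + 1)) ^ 2 * ∑ i ∈ Finset.range (k + 1), γ i
  A4 : Summable fun k => ε (k + 1) / γ (k + 1) * ∑ i ∈ Finset.range (k + 1), γ i
  A5 : Tendsto (fun k => ∑ i ∈ Finset.range k, γ i) atTop atTop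

/-- The rate `1 / √(γ 0 + ⋯ + γ (k - 1))`. -/
def rate (γ : ℕ → ℝ) (k : ℕ) : ℝ := 1 / √(∑ i ∈ Finset.range k, γ i)

/-- Simple convergence to the closest feasible problem. -/
structure SimplyConverges {H Y : Type*} [NormedAddCommGroup H] [NormedAddCommGroup Y]
    (P : ConvexProgram H Y) (x : ℕ → H) (y : ℕ → Y) : Prop where
  tendsto_value : Tendsto (fun k => P.f (x k)) atTop (𝓝 (P.value P.sBar))
  tendsto_violation : Tendsto (fun k => P.C (x k) - y k) atTop (𝓝 P.sBar)
  tendsto_slack : Tendsto (fun k => ‖y k - proj P.K (P.C (x k))‖) atTop (𝓝 0)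

/-- Semi-quantitative convergence to the closest feasible problem. -/
structure SemiQuantitativelyConverges {H Y : Type*} [NormedAddCommGroup H] [NormedAddCommGroup Y]
    (P : ConvexProgram H Y) (γ : ℕ → ℝ) (x : ℕ → H) (y : ℕ → Y) : Prop
    extends SimplyConverges P x y where
  violation_rate : (fun k => ‖P.C (x k) - y k - P.sBar‖) =O[atTop] rate γ
  slack_rate : (fun k => ‖y k - proj P.K (P.C (x k))‖) =O[atTop] rate γ

/-- Quantitative convergence to the closest feasible problem.  The optimal value of that problem is
required to be finite; by the convergence of the values, `P.f (x k)` is then finite for all large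
`k`, so that the last field compares genuine real numbers. -/
structure QuantitativelyConverges {H Y : Type*} [NormedAddCommGroup H] [NormedAddCommGroup Y]
    (P : ConvexProgram H Y) (γ : ℕ → ℝ) (x : ℕ → H) (y : ℕ → Y) : Prop
    extends SemiQuantitativelyConverges P γ x y where
  value_ne_top : P.value P.sBar ≠ ⊤
  value_ne_bot : P.value P.sBar ≠ ⊥
  value_rate : (fun k => |(P.f (x k)).toReal - (P.value P.sBar).toReal|) =O[atTop] rate γ

end ConvexProgram

end

/-! ### Finitely generated cones and Hoffman's error bound. -/

section Hoffman

variable {ι H : Type*} [NormedAddCommGroup H] [InnerProductSpace ℝ H]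

/-! Polyhedrality enters only through two facts: the set `S` of attainable violations is closed, and
the value function `N` is Lipschitz on it. The graph of `C - K` is a finite union of relations given
by linear inequalities (`exists_CC_eq_iUnion`). Hoffman's bound makes the sections of each relation
Lipschitz in the parameter, so each domain is closed and the marginal over each piece is Lipschitz.
Convexity of `N` glues the pieces (`exists_lipschitz_marginal`).

Closedness puts `sBar` in `S`. A subgradient there comes from separating the epigraph from an open
cone whose slope is the Lipschitz constant.

IALM is an inexact proximal point method on the dual: exact subproblem solutions `p k` satisfy `q k
= l k - γ k • p k ∈ ∂N (p k)`, and the iterates `s (k + 1)` lie within `ε (k + 1) / γ k` of them.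
With `T k` the sum of the first `k` steps, the multipliers may drift like `-T k • sBar`, but become
bounded after this drift is removed. The Lyapunov function `T (k + 1) * (‖p k‖ ^ 2 - ‖sBar‖ ^ 2) + v
k`, where `v k` is the conjugate value at `q k` corrected for the drift, grows only by summable
errors, and `v` is bounded below. Hence the excess of `‖p k‖ ^ 2` is `O(1 / T)`
(`exists_bound_excess_proximal_points`), and (A2) transfers this to `s (k + 1)`. The excess
dominates the squared distance to `sBar` and the squared slack, whence the square-root rates; the
Lipschitz property gives the rate for the values. -/

theorem convex_setOf_inner_le (a : ι → H) (r : ι → ℝ) :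
    Convex ℝ {z | ∀ j, inner ℝ (a j) z ≤ r j} := by
  rw [Set.ofPred_forall]
  exact convex_iInter fun j => convex_halfSpace_le (innerₗ H (a j)).isLinear _

theorem isClosed_setOf_inner_le (a : ι → H) (r : ι → ℝ) :
    IsClosed {z | ∀ j, inner ℝ (a j) z ≤ r j} := by
  rw [Set.ofPred_forall]
  exact isClosed_iInter fun j => isClosed_le (by fun_prop) continuous_const

theorem IsNearestPoint.inner_le_zero {A : Set H} (hc : Convex ℝ A) {z p : H}
    (h : IsNearestPoint A z p) : ∀ w ∈ A, inner ℝ (z - p) (w - p) ≤ 0 := by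
  have : Nonempty A := ⟨p, h.1⟩
  rw [← norm_eq_iInf_iff_real_inner_le_zero hc h.1]
  have hb : BddBelow (Set.range fun w : A => ‖z - (w : H)‖) :=
    ⟨0, Set.forall_mem_range.2 fun _ => norm_nonneg _⟩
  exact le_antisymm (le_ciInf fun w => h.2 w w.2) (ciInf_le hb ⟨p, h.1⟩)

variable [Fintype ι]

/-- Conic Carathéodory: a nonnegative combination can be rewritten with linearly independent
vectors, using only vectors that already occur. -/
theorem exists_nonneg_combination_linearIndepOn (a : ι → H) (c : ι → ℝ) (hc : ∀ j, 0 ≤ c j) :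
    ∃ c' : ι → ℝ, (∀ j, 0 ≤ c' j) ∧ (∀ j, c j = 0 → c' j = 0) ∧
      ∑ j, c' j • a j = ∑ j, c j • a j ∧ LinearIndepOn ℝ a {j | c' j ≠ 0} := by
  classical
  induction hn : (Finset.univ.filter fun j => c j ≠ 0).card using Nat.strong_induction_on
    generalizing c with
  | _ n ih =>
  by_cases hli : LinearIndepOn ℝ a {j | c j ≠ 0}
  · exact ⟨c, hc, fun _ h => h, rfl, hli⟩
  -- A dependency among the occurring vectors, negated if necessary so that some coefficient is
  -- positive.
  have hdep : ∃ g : ι → ℝ, (∀ j, c j = 0 → g j = 0) ∧ ∑ j, g j • a j = 0 ∧ ∃ j, 0 < g j := by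
    have hset : {j | c j ≠ 0} = ((Finset.univ.filter fun j => c j ≠ 0 : Finset ι) : Set ι) := by
      ext; simp
    rw [hset, linearIndepOn_finset_iff] at hli
    push Not at hli
    obtain ⟨g, hg0, i, hi, hgi⟩ := hli
    have hsum : ∑ j, (if c j ≠ 0 then g j else 0) • a j = 0 := by
      rw [← hg0, Finset.sum_filter]
      refine Finset.sum_congr rfl fun j _ => ?_
      split_ifs <;> simp
    have hi' : c i ≠ 0 := by simpa using hi
    rcases lt_or_gt_of_ne hgi with h | h
    · refine ⟨fun j => -(if c j ≠ 0 then g j else 0), fun j hj => by simp [hj], ?_, i, ?_⟩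
      · simpa only [neg_smul, Finset.sum_neg_distrib, neg_eq_zero] using hsum
      · simpa [hi'] using h
    · exact ⟨fun j => if c j ≠ 0 then g j else 0, fun j hj => by simp [hj], hsum, i,
        by simpa [hi'] using h⟩
  obtain ⟨g, hgc, hg0, i₀, hi₀⟩ := hdep
  -- Ratio test: subtracting the dependency scaled by the smallest ratio kills coefficient `i` and
  -- keeps all others nonnegative.
  obtain ⟨i, hi, hmin⟩ := Finset.exists_min_image (Finset.univ.filter fun j => 0 < g j)
    (fun j => c j / g j) ⟨i₀, by simpa using hi₀⟩
  have hgi : 0 < g i := by simpa using hi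
  have hci : c i ≠ 0 := fun h => hgi.ne' (hgc i h)
  set t := c i / g i with ht
  have ht0 : 0 ≤ t := div_nonneg (hc i) hgi.le
  have hnn : ∀ j, 0 ≤ c j - t * g j := by
    intro j
    rcases lt_or_ge 0 (g j) with h | h
    · have := hmin j (by simpa using h)
      rw [le_div_iff₀ h] at this
      linarith
    · nlinarith [hc j]
  have hsub : ∀ j, c j = 0 → c j - t * g j = 0 := fun j hj => by simp [hj, hgc j hj]
  obtain ⟨c', h0, h1, h2, h3⟩ := ih _ (by
    rw [← hn]
    refine Finset.card_lt_card (Finset.ssubset_iff_of_subset ?_ |>.2 ⟨i, by simpa using hci, ?_⟩)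
    · intro j
      simp only [Finset.mem_filter, Finset.mem_univ, true_and]
      exact fun h h' => h (hsub j h')
    · simp [ht, hgi.ne']) (fun j => c j - t * g j) hnn rfl
  refine ⟨c', h0, fun j hj => h1 j (hsub j hj), ?_, h3⟩
  rw [h2]
  simp only [sub_smul, mul_smul, Finset.sum_sub_distrib, ← Finset.smul_sum, hg0, smul_zero,
    sub_zero]

/-- Coefficients of combinations of a linearly independent family are bounded by the norm. -/
theorem exists_bound_of_linearIndepOn (a : ι → H) (I : Set ι) (hI : LinearIndepOn ℝ a I) :
    ∃ κ : ℝ, 0 ≤ κ ∧ ∀ c : ι → ℝ, (∀ j, c j ≠ 0 → j ∈ I) → ∀ i, |c i| ≤ κ * ‖∑ j, c j • a j‖ := by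
  classical
  have hI' : LinearIndependent ℝ fun j : I => a j := hI
  obtain ⟨K, -, hK⟩ := (Fintype.linearCombination ℝ fun j : I => a j).exists_antilipschitzWith
    (LinearMap.ker_eq_bot.2 hI'.fintypeLinearCombination_injective)
  refine ⟨K, K.2, fun c hc i => ?_⟩
  have hsum : ∑ j, c j • a j = Fintype.linearCombination ℝ (fun j : I => a j) fun j => c j := by
    rw [Fintype.linearCombination_apply,
      ← Finset.sum_subset (Finset.subset_univ (Finset.univ.filter (· ∈ I)))]
    · exact Finset.sum_subtype (Finset.univ.filter (· ∈ I)) (by simp) fun j => c j • a j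
    · intro j _ hj
      have : c j = 0 := by
        by_contra h
        exact hj (by simpa using hc j h)
      simp [this]
  have h := hK.le_mul_dist (fun j : I => c j) 0
  rw [map_zero, dist_zero_right, dist_zero_right, ← hsum] at h
  by_cases hi : c i = 0
  · rw [hi, abs_zero]; positivity
  · exact (norm_le_pi_norm (fun j : I => c j) ⟨i, hc i hi⟩).trans h

/-- After the Carathéodory reduction the support is independent, and there are only finitely many
supports; summing their constants gives a uniform one. -/
theorem exists_bounded_nonneg_combination (a : ι → H) :
    ∃ κ : ℝ, 0 ≤ κ ∧ ∀ c : ι → ℝ, (∀ j, 0 ≤ c j) → ∃ c' : ι → ℝ, (∀ j, 0 ≤ c' j) ∧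
      (∀ j, c j = 0 → c' j = 0) ∧ ∑ j, c' j • a j = ∑ j, c j • a j ∧
      ∀ i, c' i ≤ κ * ‖∑ j, c j • a j‖ := by
  classical
  have hb : ∀ I : Set ι, ∃ κ : ℝ, 0 ≤ κ ∧ (LinearIndepOn ℝ a I → ∀ c : ι → ℝ,
      (∀ j, c j ≠ 0 → j ∈ I) → ∀ i, |c i| ≤ κ * ‖∑ j, c j • a j‖) := by
    intro I
    by_cases hI : LinearIndepOn ℝ a I
    · obtain ⟨κ, h0, h⟩ := exists_bound_of_linearIndepOn a I hI
      exact ⟨κ, h0, fun _ => h⟩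
    · exact ⟨0, le_rfl, fun h => absurd h hI⟩
  choose κ hκ0 hκ using hb
  refine ⟨∑ I, κ I, Finset.sum_nonneg fun I _ => hκ0 I, fun c hc => ?_⟩
  obtain ⟨c', h0, h1, h2, h3⟩ := exists_nonneg_combination_linearIndepOn a c hc
  refine ⟨c', h0, h1, h2, fun i => ?_⟩
  calc c' i ≤ |c' i| := le_abs_self _
    _ ≤ κ {j | c' j ≠ 0} * ‖∑ j, c' j • a j‖ := hκ _ h3 c' (fun _ h => h) i
    _ ≤ _ := by
      rw [h2]
      gcongr
      exact Finset.single_le_sum (fun I _ => hκ0 I) (Finset.mem_univ _)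

/-- The cone generated by the vectors `a j`, `j ∈ I`. -/
def generatedCone (a : ι → H) (I : Set ι) : Set H :=
  {x | ∃ c : ι → ℝ, (∀ j, 0 ≤ c j) ∧ (∀ j, j ∉ I → c j = 0) ∧ ∑ j, c j • a j = x}

/-- Along a convergent sequence in the cone the coefficients can be kept in a compact box, so a
subsequence of them converges. -/
theorem isClosed_generatedCone (a : ι → H) (I : Set ι) : IsClosed (generatedCone a I) := by
  obtain ⟨κ, hκ0, hκ⟩ := exists_bounded_nonneg_combination a
  refine isClosed_of_closure_subset fun x hx => ?_
  obtain ⟨u, hu, hux⟩ := mem_closure_iff_seq_limit.1 hx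
  choose c hc hcI hcu using hu
  choose c' h0 h1 h2 h3 using fun n => hκ (c n) (hc n)
  obtain ⟨M, hM⟩ := hux.norm.bddAbove_range
  have hmem : ∀ n, c' n ∈ Set.Icc (0 : ι → ℝ) fun _ => κ * M := fun n =>
    ⟨fun j => h0 n j, fun j => (h3 n j).trans <| by
      rw [hcu]
      exact mul_le_mul_of_nonneg_left (hM ⟨n, rfl⟩) hκ0⟩
  obtain ⟨d, hd, φ, hφ, hlim⟩ := isCompact_Icc.tendsto_subseq hmem
  refine ⟨d, fun j => hd.1 j, fun j hj => ?_, ?_⟩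
  · refine tendsto_nhds_unique (tendsto_pi_nhds.1 hlim j) ?_
    simp [h1 _ j (hcI _ j hj)]
  · have h4 : Tendsto (fun n => ∑ j, c' (φ n) j • a j) atTop (𝓝 (∑ j, d j • a j)) :=
      tendsto_finsetSum _ fun j _ => (tendsto_pi_nhds.1 hlim j).smul_const (a j)
    refine tendsto_nhds_unique h4 ?_
    simp only [h2, hcu]
    exact hux.comp hφ.tendsto_atTop

theorem convex_generatedCone (a : ι → H) (I : Set ι) : Convex ℝ (generatedCone a I) := by
  rintro x ⟨c, h0, h1, rfl⟩ y ⟨d, g0, g1, rfl⟩ s t hs ht -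
  refine ⟨fun j => s * c j + t * d j, fun j => ?_, fun j hj => by simp [h1 j hj, g1 j hj], ?_⟩
  · have := h0 j; have := g0 j; positivity
  · simp only [add_smul, mul_smul, Finset.sum_add_distrib, Finset.smul_sum]

/-- The normal cone of a polyhedral set is generated by the active constraints. -/
theorem normal_mem_generatedCone [CompleteSpace H] (a : ι → H) (r : ι → ℝ) {p u : H}
    (hp : ∀ j, inner ℝ (a j) p ≤ r j)
    (hu : ∀ w, (∀ j, inner ℝ (a j) w ≤ r j) → inner ℝ u (w - p) ≤ 0) :
    u ∈ generatedCone a {j | inner ℝ (a j) p = r j} := by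
  classical
  set I := {j | inner ℝ (a j) p = r j} with hI
  have h0 : (0 : H) ∈ generatedCone a I := ⟨0, by simp⟩
  -- Farkas by projection: the residual `v` of `u` turns out to be a feasible direction at `p`, so
  -- `⟪u, v⟫ ≤ 0`; with `⟪v, q⟫ ≥ 0` this forces `v = 0`.
  obtain ⟨q, hq, -⟩ := existsUnique_isNearestPoint ⟨0, h0⟩ (isClosed_generatedCone a I)
    (convex_generatedCone a I) u
  have hvar := hq.inner_le_zero (convex_generatedCone a I)
  obtain ⟨c, hc0, hcI, hcq⟩ := hq.1
  set v := u - q with hv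
  have hadd : ∀ d : ι → ℝ, (∀ j, 0 ≤ c j + d j) → (∀ j, j ∉ I → d j = 0) →
      inner ℝ v (∑ j, d j • a j) ≤ 0 := by
    intro d hd hdI
    have := hvar (∑ j, (c j + d j) • a j) ⟨_, hd, fun j hj => by simp [hcI j hj, hdI j hj], rfl⟩
    simpa only [add_smul, Finset.sum_add_distrib, hcq, add_sub_cancel_left] using this
  have hva : ∀ j ∈ I, inner ℝ (a j) v ≤ 0 := by
    intro i hi
    have := hadd (Pi.single i 1) (fun j => by
      by_cases h : j = i
      · subst h; simpa using add_nonneg (hc0 j) zero_le_one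
      · simpa [h] using hc0 j) (fun j hj => by
        rw [Pi.single_eq_of_ne]; rintro rfl; exact hj hi)
    rw [real_inner_comm]
    simpa [Pi.single_apply, ite_smul] using this
  have hvq : 0 ≤ inner ℝ v q := by
    have := hadd (fun j => -c j) (fun j => by simp) (fun j hj => by simp [hcI j hj])
    simpa [hcq, neg_smul, Finset.sum_neg_distrib] using this
  have hfeas : ∀ᶠ t : ℝ in 𝓝[>] 0, ∀ j, inner ℝ (a j) (p + t • v) ≤ r j := by
    rw [Filter.eventually_all]
    intro j
    by_cases hj : j ∈ I
    · filter_upwards [self_mem_nhdsWithin] with t ht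
      have h1 := hva j hj
      have h2 : inner ℝ (a j) p = r j := hj
      have ht' : (0 : ℝ) < t := ht
      rw [inner_add_right, inner_smul_right, h2]
      nlinarith
    · have hlt : inner ℝ (a j) p < r j := lt_of_le_of_ne (hp j) hj
      have hcont : Continuous fun t : ℝ => inner ℝ (a j) (p + t • v) := by fun_prop
      have : ∀ᶠ t : ℝ in 𝓝 0, inner ℝ (a j) (p + t • v) < r j :=
        hcont.continuousAt.eventually_lt continuousAt_const (by simpa using hlt)
      exact (this.filter_mono nhdsWithin_le_nhds).mono fun _ h => h.le
  obtain ⟨t, ht, ht0⟩ := (hfeas.and self_mem_nhdsWithin).exists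
  have ht0 : (0 : ℝ) < t := ht0
  have h1 := hu _ ht
  rw [add_sub_cancel_left, inner_smul_right] at h1
  have h2 : inner ℝ u v ≤ 0 := by nlinarith
  have h3 : inner ℝ u v = inner ℝ v v + inner ℝ v q := by
    rw [← inner_add_right, hv, sub_add_cancel, real_inner_comm]
  have h4 : v = 0 := inner_self_eq_zero (𝕜 := ℝ).1
    (le_antisymm (by linarith) real_inner_self_nonneg)
  have h5 : u = q := sub_eq_zero.1 h4
  exact h5 ▸ hq.1

/-- **Hoffman's error bound** for finite systems of linear inequalities in a Hilbert space. -/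
theorem hoffman_bound [CompleteSpace H] (a : ι → H) :
    ∃ κ : ℝ, 0 ≤ κ ∧ ∀ r : ι → ℝ, (∃ z, ∀ j, inner ℝ (a j) z ≤ r j) → ∀ (x : H) (δ : ℝ), 0 ≤ δ →
      (∀ j, inner ℝ (a j) x ≤ r j + δ) → ∃ z, (∀ j, inner ℝ (a j) z ≤ r j) ∧ ‖x - z‖ ≤ κ * δ := by
  obtain ⟨κ, hκ0, hκ⟩ := exists_bounded_nonneg_combination a
  refine ⟨Fintype.card ι * κ, by positivity, fun r hne x δ hδ hx => ?_⟩
  obtain ⟨p, hp, -⟩ := existsUnique_isNearestPoint (A := {z | ∀ j, inner ℝ (a j) z ≤ r j}) hne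
    (isClosed_setOf_inner_le a r) (convex_setOf_inner_le a r) x
  have hvar := hp.inner_le_zero (convex_setOf_inner_le a r)
  obtain ⟨c, hc0, hcI, hcx⟩ := normal_mem_generatedCone a r hp.1 hvar
  obtain ⟨d, hd0, hd1, hd2, hd3⟩ := hκ c hc0
  refine ⟨p, hp.1, ?_⟩
  rw [hcx] at hd2 hd3
  -- The residual is a combination of constraints active at `p`, each exceeded at `x` by at most
  -- `δ`. As the coefficients are bounded by `κ * ‖x - p‖`, one factor `‖x - p‖` cancels.
  have h1 : ‖x - p‖ ^ 2 ≤ (∑ j, d j) * δ := by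
    calc ‖x - p‖ ^ 2 = inner ℝ (∑ j, d j • a j) (x - p) := by
          rw [hd2, real_inner_self_eq_norm_sq]
      _ = ∑ j, d j * inner ℝ (a j) (x - p) := by
          simp only [sum_inner, real_inner_smul_left]
      _ ≤ ∑ j, d j * δ := by
          refine Finset.sum_le_sum fun j _ => ?_
          by_cases hj : inner ℝ (a j) p = r j
          · have := hx j
            refine mul_le_mul_of_nonneg_left ?_ (hd0 j)
            rw [inner_sub_right]
            linarith
          · simp [hd1 j (hcI j hj)]
      _ = _ := (Finset.sum_mul _ _ _).symm
  have h2 : ∑ j, d j ≤ Fintype.card ι * κ * ‖x - p‖ := by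
    calc ∑ j, d j ≤ ∑ _j : ι, κ * ‖x - p‖ := Finset.sum_le_sum fun j _ => hd3 j
      _ = _ := by simp [mul_assoc]
  rcases (norm_nonneg (x - p)).eq_or_lt with h | h
  · rw [← h]; positivity
  · refine le_of_mul_le_mul_right ?_ h
    nlinarith

end Hoffman

/-! ### Lipschitz sections of polyhedral relations and marginal functions. -/

section PolyhedralRelations

variable {H Y : Type*} [NormedAddCommGroup H] [InnerProductSpace ℝ H]
  [NormedAddCommGroup Y] [InnerProductSpace ℝ Y]

/-- A relation between Hilbert spaces given by finitely many linear inequalities. -/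
def IsPolyhedralRel {H Y : Type*} [NormedAddCommGroup H] [InnerProductSpace ℝ H]
    [NormedAddCommGroup Y] [InnerProductSpace ℝ Y] (Q : Set (H × Y)) : Prop :=
  ∃ (n : ℕ) (a : Fin n → H) (b : Fin n → Y) (c : Fin n → ℝ),
    Q = {p | ∀ j, inner ℝ (a j) p.1 + inner ℝ (b j) p.2 ≤ c j}

theorem IsPolyhedralRel.of_fintype {ι : Type*} [Fintype ι] (a : ι → H) (b : ι → Y) (c : ι → ℝ) :
    IsPolyhedralRel {p : H × Y | ∀ j, inner ℝ (a j) p.1 + inner ℝ (b j) p.2 ≤ c j} := by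
  let e := (Fintype.equivFin ι).symm
  refine ⟨Fintype.card ι, a ∘ e, b ∘ e, c ∘ e, ?_⟩
  ext p
  exact ⟨fun h i => h (e i), fun h j => by simpa using h (e.symm j)⟩

theorem IsPolyhedralRel.isClosed {Q : Set (H × Y)} (hQ : IsPolyhedralRel Q) : IsClosed Q := by
  obtain ⟨n, a, b, c, rfl⟩ := hQ
  rw [Set.ofPred_forall]
  exact isClosed_iInter fun j => isClosed_le (by fun_prop) continuous_const

variable [CompleteSpace H]

/-- The sections of a polyhedral relation depend Lipschitz continuously on the parameter. -/
theorem IsPolyhedralRel.exists_lipschitz_section {Q : Set (H × Y)} (hQ : IsPolyhedralRel Q) :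
    ∃ κ : ℝ, 0 ≤ κ ∧ ∀ s', (∃ x', (x', s') ∈ Q) → ∀ x s, (x, s) ∈ Q →
      ∃ x', (x', s') ∈ Q ∧ ‖x - x'‖ ≤ κ * ‖s - s'‖ := by
  obtain ⟨n, a, b, c, rfl⟩ := hQ
  obtain ⟨κ, hκ0, hκ⟩ := hoffman_bound a
  have hB : 0 ≤ ∑ j, ‖b j‖ := Finset.sum_nonneg fun j _ => norm_nonneg _
  refine ⟨κ * ∑ j, ‖b j‖, by positivity, fun s' hs' x s hxs => ?_⟩
  -- The parameter only changes right-hand sides, so Hoffman's constant for `a` serves every `s'`.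
  obtain ⟨z, hz, hxz⟩ := hκ (fun j => c j - inner ℝ (b j) s')
    (hs'.imp fun z hz j => by have : _ ≤ c j := hz j; simp only at this; linarith)
    x ((∑ j, ‖b j‖) * ‖s - s'‖) (by positivity) (fun j => by
      have h1 : inner ℝ (a j) x + inner ℝ (b j) s ≤ c j := hxs j
      have h2 : |inner ℝ (b j) (s - s')| ≤ ‖b j‖ * ‖s - s'‖ := abs_real_inner_le_norm _ _
      have h3 : ‖b j‖ * ‖s - s'‖ ≤ (∑ j, ‖b j‖) * ‖s - s'‖ := by
        gcongr
        exact Finset.single_le_sum (f := fun j => ‖b j‖) (fun j _ => norm_nonneg _)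
          (Finset.mem_univ j)
      rw [inner_sub_right] at h2
      have := neg_le_of_abs_le h2
      linarith)
  exact ⟨z, fun j => by have := hz j; simp only; linarith, by rwa [mul_assoc]⟩

/-- Closed sets need not project to closed sets. Here parameters approaching `s` geometrically can
be lifted one after another by the Lipschitz sections, and the lifts form a Cauchy sequence. -/
theorem IsPolyhedralRel.isClosed_dom {Q : Set (H × Y)} (hQ : IsPolyhedralRel Q) :
    IsClosed {s | ∃ x, (x, s) ∈ Q} := by
  obtain ⟨κ, hκ0, hκ⟩ := hQ.exists_lipschitz_section
  refine isClosed_of_closure_subset fun s hs => ?_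
  have hs' : ∀ n : ℕ, ∃ t, (∃ x, (x, t) ∈ Q) ∧ ‖t - s‖ ≤ (1 / 2) ^ n := fun n => by
    obtain ⟨t, ht, hd⟩ := Metric.mem_closure_iff.1 hs ((1 / 2) ^ n) (by positivity)
    exact ⟨t, ht, by rw [← dist_eq_norm, dist_comm]; exact hd.le⟩
  choose t ht hts using hs'
  choose g hgQ hg using fun n (x : {x // (x, t n) ∈ Q}) => hκ (t (n + 1)) (ht (n + 1)) x (t n) x.2
  let u : ∀ n, {x // (x, t n) ∈ Q} := fun n =>
    Nat.rec ⟨(ht 0).choose, (ht 0).choose_spec⟩ (fun n x => ⟨g n x, hgQ n x⟩) n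
  have hu : ∀ n, dist (u n).1 (u (n + 1)).1 ≤ 2 * κ * (1 / 2) ^ n := fun n => by
    have h1 : ‖(u n).1 - (u (n + 1)).1‖ ≤ κ * ‖t n - t (n + 1)‖ := hg n (u n)
    have h2 : ‖t n - t (n + 1)‖ ≤ 2 * (1 / 2) ^ n := by
      have h3 := norm_sub_le (t n - s) (t (n + 1) - s)
      rw [sub_sub_sub_cancel_right] at h3
      have h4 := hts n
      have h5 := hts (n + 1)
      have h6 : (0 : ℝ) ≤ (1 / 2) ^ n := by positivity
      rw [pow_succ] at h5
      linarith
    rw [dist_eq_norm]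
    nlinarith
  obtain ⟨x, hx⟩ := cauchySeq_tendsto_of_complete
    (cauchySeq_of_le_geometric (1 / 2) (2 * κ) (by norm_num) hu)
  have htlim : Tendsto t atTop (𝓝 s) := by
    rw [tendsto_iff_norm_sub_tendsto_zero]
    exact squeeze_zero (fun n => norm_nonneg _) hts
      (tendsto_pow_atTop_nhds_zero_of_lt_one (by norm_num) (by norm_num))
  exact ⟨x, hQ.isClosed.mem_of_tendsto (hx.prodMk_nhds htlim) (Eventually.of_forall fun n => (u n).2)⟩

/-- The marginal function of a Lipschitz function over a finite union of polyhedral relations is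
Lipschitz continuous on its domain, if it is convex. -/
theorem exists_lipschitz_marginal {n : ℕ} {Q : Fin n → Set (H × Y)}
    (hQ : ∀ i, IsPolyhedralRel (Q i)) {F : H → ℝ} {N : Y → ℝ} {S : Set Y} {L : ℝ} (hL : 0 ≤ L)
    (hF : ∀ i j, ∀ p ∈ Q i, ∀ q ∈ Q j, F p.1 ≤ F q.1 + L * ‖p.1 - q.1‖)
    (hN : ∀ i x s, (x, s) ∈ Q i → N s ≤ F x)
    (hN' : ∀ s ∈ S, ∀ δ > 0, ∃ i x, (x, s) ∈ Q i ∧ F x < N s + δ)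
    (hconv : ConvexOn ℝ S N) :
    ∃ M : ℝ, 0 ≤ M ∧ ∀ s' ∈ S, ∀ s ∈ S, N s' ≤ N s + M * ‖s' - s‖ := by
  choose κ hκ0 hκ using fun i => (hQ i).exists_lipschitz_section
  have hK : ∀ i, κ i ≤ ∑ i, κ i := fun i =>
    Finset.single_le_sum (f := κ) (fun i _ => hκ0 i) (Finset.mem_univ i)
  have hK0 : 0 ≤ ∑ i, κ i := Finset.sum_nonneg fun i _ => hκ0 i
  refine ⟨L * ∑ i, κ i, by positivity, fun s' hs' s hs => ?_⟩
  -- A piece whose closed domain misses `s'` misses a neighbourhood of it. With finitely many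
  -- pieces, every piece present at a nearby point of the segment is present at `s'`.
  have hev : ∀ᶠ τ : ℝ in 𝓝[>] 0, ∀ i, (∃ x, (x, s' + τ • (s - s')) ∈ Q i) → ∃ x, (x, s') ∈ Q i := by
    rw [Filter.eventually_all]
    intro i
    by_cases h : ∃ x, (x, s') ∈ Q i
    · exact Eventually.of_forall fun _ _ => h
    · have hc : Continuous fun τ : ℝ => s' + τ • (s - s') := by fun_prop
      have ho : {s | ∃ x, (x, s) ∈ Q i}ᶜ ∈ 𝓝 (s' + (0 : ℝ) • (s - s')) := by
        refine (hQ i).isClosed_dom.isOpen_compl.mem_nhds ?_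
        simpa using h
      filter_upwards [nhdsWithin_le_nhds (hc.tendsto 0 ho)] with τ h1 h2 using absurd h2 h1
  obtain ⟨τ, hτ, hτ0, hτ1⟩ := (hev.and (Ioo_mem_nhdsGT (zero_lt_one' ℝ))).exists
  have heq : s' + τ • (s - s') = (1 - τ) • s' + τ • s := by module
  have htS : s' + τ • (s - s') ∈ S := by
    rw [heq]; exact hconv.1 hs' hs (by linarith) hτ0.le (by ring)
  have hc := hconv.2 hs' hs (by linarith : 0 ≤ 1 - τ) hτ0.le (by ring)
  rw [← heq, smul_eq_mul, smul_eq_mul] at hc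
  have hlip : N s' ≤ N (s' + τ • (s - s')) + L * (∑ i, κ i) * (τ * ‖s' - s‖) := by
    refine le_of_forall_pos_le_add fun δ hδ => ?_
    obtain ⟨i, x, hx, hxδ⟩ := hN' _ htS δ hδ
    obtain ⟨x', hx', hxx⟩ := hκ i s' (hτ i ⟨x, hx⟩) x _ hx
    have h1 := hN i x' s' hx'
    have h2 := hF i i _ hx' _ hx
    have h3 : ‖s' + τ • (s - s') - s'‖ = τ * ‖s' - s‖ := by
      rw [add_sub_cancel_left, norm_smul, Real.norm_of_nonneg hτ0.le, norm_sub_rev]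
    rw [h3] at hxx
    have h4 : ‖x' - x‖ ≤ (∑ i, κ i) * (τ * ‖s' - s‖) := by
      rw [norm_sub_rev]
      exact hxx.trans (mul_le_mul_of_nonneg_right (hK i) (mul_nonneg hτ0.le (norm_nonneg _)))
    have h5 := mul_le_mul_of_nonneg_left h4 hL
    simp only at h2
    rw [mul_assoc]
    linarith
  -- The local estimate at `s'` and convexity along the segment leave a common factor `τ`: convexity
  -- turns the local slope into a global one.
  refine le_of_mul_le_mul_left ?_ hτ0
  linarith

end PolyhedralRelations

/-! ### Subgradients by separation. -/

section Subgradient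

variable {Y : Type*} [NormedAddCommGroup Y] [InnerProductSpace ℝ Y] [CompleteSpace Y]

/-- A Lipschitz continuous convex function on a convex set has a subgradient at every point. -/
theorem exists_subgradient_of_lipschitz {S : Set Y} {N : Y → ℝ} (hconv : ConvexOn ℝ S N) {M : ℝ}
    {s : Y} (hs : s ∈ S) (hM : ∀ t ∈ S, N s ≤ N t + M * ‖s - t‖) (hM0 : 0 ≤ M) :
    ∃ l : Y, ∀ t ∈ S, N s + inner ℝ l (t - s) ≤ N t := by
  -- The open downward cone of slope `M` with apex `(s, N s)` lies below the epigraph; its openness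
  -- replaces interior points of `S`, which may not exist.
  have hBo : IsOpen {p : Y × ℝ | M * ‖p.1 - s‖ + p.2 < N s} :=
    isOpen_lt (by fun_prop) continuous_const
  have hBc : Convex ℝ {p : Y × ℝ | M * ‖p.1 - s‖ + p.2 < N s} := by
    rintro ⟨p, r⟩ hp ⟨q, r'⟩ hq a b ha hb hab
    simp only [Set.mem_ofPred_eq, Prod.smul_mk, Prod.mk_add_mk, smul_eq_mul] at hp hq ⊢
    have h1 : ‖a • p + b • q - s‖ ≤ a * ‖p - s‖ + b * ‖q - s‖ := by
      have : a • p + b • q - s = a • (p - s) + b • (q - s) := by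
        obtain rfl : b = 1 - a := by linarith
        module
      rw [this]
      refine (norm_add_le _ _).trans ?_
      rw [norm_smul, norm_smul, Real.norm_of_nonneg ha, Real.norm_of_nonneg hb]
    have h2 := mul_le_mul_of_nonneg_left h1 hM0
    rcases ha.eq_or_lt with rfl | ha
    · obtain rfl : b = 1 := by linarith
      linarith
    · have h3 := mul_lt_mul_of_pos_left hp ha
      have h4 := mul_le_mul_of_nonneg_left hq.le hb
      have h5 : a * N s + b * N s = N s := by rw [← add_mul, hab, one_mul]
      linarith
  have hdisj : Disjoint {p : Y × ℝ | M * ‖p.1 - s‖ + p.2 < N s} {p | p.1 ∈ S ∧ N p.1 ≤ p.2} := by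
    rw [Set.disjoint_left]
    rintro ⟨p, r⟩ hp ⟨hpS, hpr⟩
    have := hM p hpS
    rw [norm_sub_rev] at this
    simp only [Set.mem_ofPred_eq] at hp hpr
    linarith
  obtain ⟨φ, u, h1, h2⟩ := geometric_hahn_banach_open hBc hBo hconv.convex_epigraph hdisj
  set α : ℝ := φ (0, 1) with hα
  set w := (InnerProductSpace.toDual ℝ Y).symm (φ.comp (ContinuousLinearMap.inl ℝ Y ℝ)) with hw
  have hφ : ∀ t r, φ (t, r) = inner ℝ w t + r * α := by
    intro t r
    have e1 : inner ℝ w t = φ (t, 0) := by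
      rw [hw, InnerProductSpace.toDual_symm_apply]; rfl
    have e2 : r * α = φ (0, r) := by
      rw [hα, ← smul_eq_mul, ← map_smul]; simp
    rw [e1, e2, ← map_add]
    simp
  have h3 : u ≤ inner ℝ w s + N s * α := by rw [← hφ]; exact h2 _ ⟨hs, le_rfl⟩
  have h4 : ∀ δ > 0, inner ℝ w s + (N s - δ) * α < u := fun δ hδ => by
    rw [← hφ]; exact h1 _ (by simpa using hδ)
  -- The vertical line through `(s, N s)` meets both separated sets, so the hyperplane is not
  -- vertical.
  have hα0 : 0 < α := by have := h4 1 one_pos; nlinarith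
  have h5 : inner ℝ w s + N s * α ≤ u := by
    refine le_of_forall_pos_le_add fun δ hδ => ?_
    have := h4 (δ / α) (by positivity)
    rw [sub_mul, div_mul_cancel₀ _ hα0.ne'] at this
    linarith
  refine ⟨-(α⁻¹ • w), fun t ht => ?_⟩
  have h6 : u ≤ inner ℝ w t + N t * α := by rw [← hφ]; exact h2 _ ⟨ht, le_rfl⟩
  rw [inner_neg_left, real_inner_smul_left, inner_sub_right]
  have h7 : α⁻¹ * (inner ℝ w t - inner ℝ w s) ≥ α⁻¹ * (α * (N s - N t)) :=
    mul_le_mul_of_nonneg_left (by nlinarith) (by positivity)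
  rw [inv_mul_cancel_left₀ hα0.ne'] at h7
  linarith

end Subgradient

/-! ### Exact and approximate proximal points. -/

section ProximalStep

variable {Y : Type*} [NormedAddCommGroup Y] [InnerProductSpace ℝ Y]

/-- Existence of a proximal step: `l - g • p` is a subgradient at `p` for some `p`. -/
theorem exists_proximal_point [CompleteSpace Y] {S : Set Y} (hne : S.Nonempty) (hcl : IsClosed S)
    {N : Y → ℝ} (hconv : ConvexOn ℝ S N) {M : ℝ} (hM0 : 0 ≤ M)
    (hM : ∀ s ∈ S, ∀ t ∈ S, N s ≤ N t + M * ‖s - t‖) (l : Y) {g : ℝ} (hg : 0 < g) :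
    ∃ p ∈ S, ∀ t ∈ S, N p + inner ℝ (l - g • p) (t - p) ≤ N t := by
  obtain ⟨s₀, hs₀⟩ := hne
  set φ : Y → ℝ := fun s => N s - inner ℝ l s + g / 2 * ‖s‖ ^ 2 with hφ
  -- The Lipschitz bound limits the descent of `N` to linear growth; completing the square gives the
  -- constant.
  have hbdd : BddBelow (φ '' S) := by
    refine ⟨N s₀ - M * ‖s₀‖ - (M + ‖l‖) ^ 2 / (2 * g), ?_⟩
    rintro _ ⟨s, hs, rfl⟩
    have h1 := hM s₀ hs₀ s hs
    have h2 := mul_le_mul_of_nonneg_left (norm_sub_le s₀ s) hM0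
    have h3 := real_inner_le_norm l s
    have h4 : (M + ‖l‖) * ‖s‖ ≤ g / 2 * ‖s‖ ^ 2 + (M + ‖l‖) ^ 2 / (2 * g) := by
      rw [← sub_nonneg]
      have : g / 2 * ‖s‖ ^ 2 + (M + ‖l‖) ^ 2 / (2 * g) - (M + ‖l‖) * ‖s‖
          = (g * ‖s‖ - (M + ‖l‖)) ^ 2 / (2 * g) := by field_simp; ring
      rw [this]; positivity
    simp only [hφ]
    linarith
  set m := sInf (φ '' S) with hm
  have hmle : ∀ s ∈ S, m ≤ φ s := fun s hs => csInf_le hbdd ⟨s, hs, rfl⟩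
  have hseq : ∀ n : ℕ, ∃ s ∈ S, φ s < m + 1 / ((n : ℝ) + 1) := fun n => by
    obtain ⟨_, ⟨s, hs, rfl⟩, h⟩ := exists_lt_of_csInf_lt (Set.Nonempty.image φ ⟨s₀, hs₀⟩)
      (lt_add_of_pos_right m (Nat.one_div_pos_of_nat (α := ℝ) (n := n)))
    exact ⟨s, hs, h⟩
  choose s hsS hsφ using hseq
  -- Strong convexity tested at the midpoint makes the minimizing sequence Cauchy, so no weak
  -- compactness is needed.
  have hmid : ∀ a ∈ S, ∀ b ∈ S, g / 8 * ‖a - b‖ ^ 2 ≤ (φ a - m + (φ b - m)) / 2 := by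
    intro a ha b hb
    have h1 := hmle _ (hconv.1 ha hb (by norm_num : (0 : ℝ) ≤ 1 / 2)
      (by norm_num : (0 : ℝ) ≤ 1 / 2) (by norm_num))
    have h2 := hconv.2 ha hb (by norm_num : (0 : ℝ) ≤ 1 / 2)
      (by norm_num : (0 : ℝ) ≤ 1 / 2) (by norm_num)
    have h3 : ‖(1 / 2 : ℝ) • a + (1 / 2 : ℝ) • b‖ ^ 2
        = (‖a‖ ^ 2 + ‖b‖ ^ 2) / 2 - ‖a - b‖ ^ 2 / 4 := by
      rw [norm_add_sq_real, norm_sub_sq_real, norm_smul, norm_smul, real_inner_smul_left,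
        real_inner_smul_right]
      norm_num
      ring
    simp only [hφ, h3, inner_add_right, real_inner_smul_right, smul_eq_mul] at h1 h2 ⊢
    nlinarith
  have hcau : CauchySeq s := by
    have hlim : Tendsto (fun n : ℕ => √(8 / g * (1 / ((n : ℝ) + 1)))) atTop (𝓝 0) := by
      have := (tendsto_one_div_add_atTop_nhds_zero_nat (𝕜 := ℝ)).const_mul (8 / g)
      rw [mul_zero] at this
      simpa using this.sqrt
    refine cauchySeq_of_le_tendsto_0 _ (fun n k N hn hk => ?_) hlim
    rw [dist_eq_norm]
    refine Real.le_sqrt_of_sq_le ?_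
    have h1 := hmid _ (hsS n) _ (hsS k)
    have h2 := (hsφ n).trans_le (add_le_add_right (Nat.one_div_le_one_div (α := ℝ) hn) m)
    have h3 := (hsφ k).trans_le (add_le_add_right (Nat.one_div_le_one_div (α := ℝ) hk) m)
    have h4 : g / 8 * ‖s n - s k‖ ^ 2 ≤ 1 / ((N : ℝ) + 1) := by linarith
    calc ‖s n - s k‖ ^ 2 = 8 / g * (g / 8 * ‖s n - s k‖ ^ 2) := by field_simp
      _ ≤ _ := by gcongr
  obtain ⟨p, hp⟩ := cauchySeq_tendsto_of_complete hcau
  have hpS : p ∈ S := hcl.mem_of_tendsto hp (Eventually.of_forall hsS)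
  have hpm : φ p ≤ m := by
    have h1 : Tendsto (fun n : ℕ => m + 1 / ((n : ℝ) + 1) + M * ‖p - s n‖
        + (inner ℝ l (s n) - inner ℝ l p) + g / 2 * (‖p‖ ^ 2 - ‖s n‖ ^ 2)) atTop
        (𝓝 (m + 0 + M * ‖p - p‖ + (inner ℝ l p - inner ℝ l p)
          + g / 2 * (‖p‖ ^ 2 - ‖p‖ ^ 2))) :=
      (((tendsto_const_nhds.add (tendsto_one_div_add_atTop_nhds_zero_nat (𝕜 := ℝ))).add
        ((tendsto_const_nhds.sub hp).norm.const_mul M)).add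
        ((tendsto_const_nhds.inner hp).sub_const _)).add
        ((tendsto_const_nhds.sub (hp.norm.pow 2)).const_mul _)
    simp only [sub_self, norm_zero, mul_zero, add_zero] at h1
    refine ge_of_tendsto' h1 fun n => ?_
    have h2 := hM p hpS (s n) (hsS n)
    have h3 := hsφ n
    simp only [hφ] at h3 ⊢
    linarith
  refine ⟨p, hpS, fun t ht => ?_⟩
  -- First-order optimality: compare `p` with `p + τ • (t - p)`, divide by `τ`, then let `τ → 0`.
  have hτ : ∀ τ : ℝ, 0 < τ → τ ≤ 1 →
      N p + inner ℝ (l - g • p) (t - p) ≤ N t + τ * (g / 2 * ‖t - p‖ ^ 2) := by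
    intro τ h0 h1
    have heq : p + τ • (t - p) = (1 - τ) • p + τ • t := by module
    have h2 := hconv.2 hpS ht (by linarith : 0 ≤ 1 - τ) h0.le (by ring)
    have h3 := hpm.trans (hmle _ (hconv.1 hpS ht (by linarith : 0 ≤ 1 - τ) h0.le (by ring)))
    rw [← heq] at h2 h3
    simp only [hφ, norm_add_sq_real, inner_add_right, inner_smul_right, norm_smul, smul_eq_mul,
      mul_pow, Real.norm_eq_abs, sq_abs] at h2 h3
    rw [inner_sub_left, inner_smul_left]
    simp only [conj_trivial]
    refine le_of_mul_le_mul_left ?_ h0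
    nlinarith
  have hlim : Tendsto (fun τ : ℝ => N t + τ * (g / 2 * ‖t - p‖ ^ 2)) (𝓝[>] 0) (𝓝 (N t)) := by
    have : Continuous fun τ : ℝ => N t + τ * (g / 2 * ‖t - p‖ ^ 2) := by fun_prop
    simpa using (this.tendsto 0).mono_left nhdsWithin_le_nhds
  refine ge_of_tendsto hlim ?_
  filter_upwards [Ioo_mem_nhdsGT (zero_lt_one' ℝ)] with τ h using hτ τ h.1 h.2.le

/-- Approximate minimizers of a proximal subproblem are close to the proximal point. -/
theorem norm_sub_proximal_point_le {N : Y → ℝ} {l p s : Y} {g e : ℝ} (hg : 0 < g) (he : 0 ≤ e)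
    (hp : N p + inner ℝ (l - g • p) (s - p) ≤ N s)
    (hs : N s - inner ℝ l s + g / 2 * ‖s‖ ^ 2
      ≤ N p - inner ℝ l p + g / 2 * ‖p‖ ^ 2 + e ^ 2 / (2 * g)) :
    ‖s - p‖ ≤ e / g := by
  have h1 : g / 2 * ‖s - p‖ ^ 2 ≤ e ^ 2 / (2 * g) := by
    rw [inner_sub_left, inner_sub_right, inner_sub_right, real_inner_smul_left,
      real_inner_smul_left, real_inner_self_eq_norm_sq] at hp
    rw [norm_sub_sq_real, real_inner_comm p s]
    linarith
  refine abs_le_of_sq_le_sq' ?_ (by positivity) |>.2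
  calc ‖s - p‖ ^ 2 = 2 / g * (g / 2 * ‖s - p‖ ^ 2) := by field_simp
    _ ≤ 2 / g * (e ^ 2 / (2 * g)) := by gcongr
    _ = (e / g) ^ 2 := by field_simp

end ProximalStep

/-! ### Inexact proximal point iteration with summable errors. -/

theorem le_add_tsum_of_le_add {u d : ℕ → ℝ} (hd : Summable d) (hd0 : ∀ k, 0 ≤ d k)
    (h : ∀ k, u (k + 1) ≤ u k + d k) (k : ℕ) : u k ≤ u 0 + ∑' i, d i := by
  have h1 : u k ≤ u 0 + ∑ i ∈ Finset.range k, d i := by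
    induction k with
    | zero => simp
    | succ k ih => rw [Finset.sum_range_succ]; linarith [h k]
  have := hd.sum_le_tsum (Finset.range k) fun i _ => hd0 i
  linarith

section InexactProximalPoint

variable {Y : Type*} [NormedAddCommGroup Y] [InnerProductSpace ℝ Y]

open ConvexProgram in
/-- Decay of the excess `‖p k‖ ^ 2 - ‖sb‖ ^ 2` along the exact proximal points `p k` of an inexact
proximal multiplier sequence `l k`, where `sb` has the smallest norm in the domain `S`. -/
theorem exists_bound_excess_proximal_points {S : Set Y} {N : Y → ℝ} {sb lb : Y}
    (hsbS : sb ∈ S) (hsb : ∀ t ∈ S, 0 ≤ inner ℝ sb (t - sb))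
    (hlb : ∀ t ∈ S, N sb + inner ℝ lb (t - sb) ≤ N t)
    {γ ε : ℕ → ℝ} (hA : StepErrorAssumption γ ε) {l p : ℕ → Y} (hpS : ∀ k, p k ∈ S)
    (hp : ∀ k, ∀ t ∈ S, N (p k) + inner ℝ (l k - γ k • p k) (t - p k) ≤ N t)
    (hl : ∀ k, ‖l k - γ k • p k - l (k + 1)‖ ≤ ε (k + 1)) :
    ∃ R C : ℝ, 0 ≤ R ∧ ∀ k, ‖p k‖ ≤ R ∧
      (∑ i ∈ Finset.range (k + 1), γ i) * (‖p k‖ ^ 2 - ‖sb‖ ^ 2) ≤ C := by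
  set T : ℕ → ℝ := fun k => ∑ i ∈ Finset.range k, γ i with hT
  have hTs : ∀ k, T (k + 1) = T k + γ k := fun k => Finset.sum_range_succ _ _
  have hT0 : ∀ k, 0 ≤ T k := fun k => Finset.sum_nonneg fun i _ => (hA.step_pos i).le
  have hTγ : ∀ k, γ 0 ≤ T (k + 1) := fun k =>
    Finset.single_le_sum (f := γ) (fun i _ => (hA.step_pos i).le) (by simp)
  set q : ℕ → Y := fun k => l k - γ k • p k with hq
  -- quasi-monotonicity of the norms
  have hmono : ∀ k, ‖p (k + 1)‖ ^ 2 ≤ ‖p k‖ ^ 2 + (ε (k + 1) / γ (k + 1)) ^ 2 := by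
    intro k
    have hγ := hA.step_pos (k + 1)
    have h1 := hp k _ (hpS (k + 1))
    have h2 := hp (k + 1) _ (hpS k)
    -- Monotonicity of the subdifferential at `p k` and `p (k + 1)`.
    have h3 : inner ℝ (q k - l (k + 1) + γ (k + 1) • p (k + 1)) (p (k + 1) - p k) ≤ 0 := by
      have e1 : q k - l (k + 1) + γ (k + 1) • p (k + 1) = q k - q (k + 1) := by
        simp only [hq]; abel
      have e2 : inner ℝ (q (k + 1)) (p k - p (k + 1)) = - inner ℝ (q (k + 1)) (p (k + 1) - p k) := by
        rw [← inner_neg_right, neg_sub]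
      rw [e1, inner_sub_left]
      linarith
    rw [inner_add_left, real_inner_smul_left] at h3
    have h4 := neg_le_of_abs_le (abs_real_inner_le_norm (q k - l (k + 1)) (p (k + 1) - p k))
    have h5 := mul_le_mul_of_nonneg_right (hl k) (norm_nonneg (p (k + 1) - p k))
    have h6 : inner ℝ (p (k + 1)) (p (k + 1) - p k)
        ≤ ε (k + 1) / γ (k + 1) * ‖p (k + 1) - p k‖ := by
      rw [div_mul_eq_mul_div, le_div_iff₀ hγ]
      linarith
    have h7 : ‖p k‖ ^ 2 = ‖p (k + 1)‖ ^ 2 - 2 * inner ℝ (p (k + 1)) (p (k + 1) - p k)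
        + ‖p (k + 1) - p k‖ ^ 2 := by
      rw [← norm_sub_sq_real, sub_sub_cancel]
    nlinarith [sq_nonneg (‖p (k + 1) - p k‖ - ε (k + 1) / γ (k + 1))]
  have hsq : Summable fun k => (ε (k + 1) / γ (k + 1)) ^ 2 := by
    refine Summable.of_nonneg_of_le (fun k => sq_nonneg _) (fun k => ?_)
      (hA.A3.mul_left (γ 0)⁻¹)
    have h1 := mul_le_mul_of_nonneg_left (hTγ k) (sq_nonneg (ε (k + 1) / γ (k + 1)))
    rw [le_inv_mul_iff₀ (hA.step_pos 0), mul_comm (γ 0)]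
    exact h1
  have hpB := le_add_tsum_of_le_add (u := fun k => ‖p k‖ ^ 2) hsq (fun k => sq_nonneg _) hmono
  set R := √(‖p 0‖ ^ 2 + ∑' k, (ε (k + 1) / γ (k + 1)) ^ 2) with hR
  have hpR : ∀ k, ‖p k‖ ≤ R := fun k => Real.le_sqrt_of_sq_le (hpB k)
  -- Fejér monotonicity of the shifted multipliers
  have hstep : ∀ k, ‖q k - lb + T (k + 1) • sb‖ ≤ ‖l k - lb + T k • sb‖ := by
    intro k
    -- Two signs combine: monotonicity between the subgradients `q k` at `p k` and `lb` at `sb`, and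
    -- the fact that `-sb` is normal to `S` at `sb`.
    have h1 := hp k sb hsbS
    have h2 := hlb _ (hpS k)
    have h3 : 0 ≤ inner ℝ (q k - lb + T (k + 1) • sb) (p k - sb) := by
      have e1 : inner ℝ (l k - γ k • p k) (sb - p k) = - inner ℝ (q k) (p k - sb) := by
        rw [← inner_neg_right, neg_sub]
      rw [inner_add_left, inner_sub_left, real_inner_smul_left]
      have := mul_nonneg (hT0 (k + 1)) (hsb _ (hpS k))
      linarith
    have e2 : l k - lb + T k • sb = (q k - lb + T (k + 1) • sb) + γ k • (p k - sb) := by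
      rw [hTs]; simp only [hq]; module
    refine abs_le_of_sq_le_sq' ?_ (norm_nonneg _) |>.2
    rw [e2, norm_add_sq_real (q k - lb + T (k + 1) • sb), real_inner_smul_right]
    have := mul_nonneg (hA.step_pos k).le h3
    nlinarith [sq_nonneg ‖γ k • (p k - sb)‖]
  have hμ : ∀ k, ‖l (k + 1) - lb + T (k + 1) • sb‖ ≤ ‖l k - lb + T k • sb‖ + ε (k + 1) := by
    intro k
    have e1 : l (k + 1) - lb + T (k + 1) • sb
        = (q k - lb + T (k + 1) • sb) - (q k - l (k + 1)) := by abel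
    rw [e1]
    exact (norm_sub_le _ _).trans (add_le_add (hstep k) (hl k))
  have hμB := le_add_tsum_of_le_add (u := fun k => ‖l k - lb + T k • sb‖) hA.A1 hA.err_nonneg hμ
  set B := ‖l 0 - lb + T 0 • sb‖ + ∑' k, ε (k + 1) with hB
  -- the dual values along the shifted trajectory
  set v : ℕ → ℝ := fun k => inner ℝ (q k) (p k) - N (p k) + T (k + 1) * ‖sb‖ ^ 2 with hv
  have hvlow : ∀ k, -(B * ‖sb‖) + inner ℝ lb sb - N sb ≤ v k := by
    intro k
    -- Fenchel–Young at `sb` bounds the conjugate value below by `⟪q k, sb⟫ - N sb`; the term `T (k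
    -- + 1) * ‖sb‖ ^ 2` offsets the drift in this inner product.
    have h1 := hp k sb hsbS
    rw [inner_sub_right] at h1
    have h2 := neg_le_of_abs_le (abs_real_inner_le_norm (q k - lb + T (k + 1) • sb) sb)
    have h3 := mul_le_mul_of_nonneg_right ((hstep k).trans (hμB k)) (norm_nonneg sb)
    rw [inner_add_left, inner_sub_left, real_inner_smul_left, real_inner_self_eq_norm_sq] at h2
    simp only [hv, hq] at h2 ⊢
    linarith
  have hvstep : ∀ k, γ (k + 1) * (‖p (k + 1)‖ ^ 2 - ‖sb‖ ^ 2)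
      ≤ v k - v (k + 1) + ε (k + 1) * R := by
    intro k
    have h1 := hp k _ (hpS (k + 1))
    have h2 := neg_le_of_abs_le (abs_real_inner_le_norm (q k - l (k + 1)) (p (k + 1)))
    have h3 : ‖q k - l (k + 1)‖ * ‖p (k + 1)‖ ≤ ε (k + 1) * R :=
      mul_le_mul (hl k) (hpR _) (norm_nonneg _) (hA.err_nonneg k)
    have e1 : inner ℝ (q (k + 1)) (p (k + 1)) = inner ℝ (l (k + 1)) (p (k + 1))
        - γ (k + 1) * ‖p (k + 1)‖ ^ 2 := by
      simp only [hq]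
      rw [inner_sub_left, real_inner_smul_left, real_inner_self_eq_norm_sq]
    rw [inner_sub_left] at h2
    rw [inner_sub_right] at h1
    simp only [hv]
    rw [e1, hTs (k + 1)]
    linarith
  -- the Lyapunov function
  have hd : Summable fun k => (ε (k + 1) / γ (k + 1)) ^ 2 * T (k + 1) + ε (k + 1) * R :=
    hA.A3.add (hA.A1.mul_right R)
  -- Replacing `T (k + 1)` by `T (k + 2)` costs `γ (k + 1)` times the excess, which is what the drop
  -- in `v` pays for.
  have hW := le_add_tsum_of_le_add (u := fun k => T (k + 1) * (‖p k‖ ^ 2 - ‖sb‖ ^ 2) + v k) hd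
    (fun k => add_nonneg (mul_nonneg (sq_nonneg _) (hT0 _))
      (mul_nonneg (hA.err_nonneg k) (Real.sqrt_nonneg _))) (fun k => by
      have h1 := hvstep k
      have h2 := mul_le_mul_of_nonneg_left (hmono k) (hT0 (k + 1))
      rw [hTs (k + 1)]
      linarith)
  refine ⟨R, T (0 + 1) * (‖p 0‖ ^ 2 - ‖sb‖ ^ 2) + v 0 +
    ∑' k, ((ε (k + 1) / γ (k + 1)) ^ 2 * T (k + 1) + ε (k + 1) * R)
    - (-(B * ‖sb‖) + inner ℝ lb sb - N sb), Real.sqrt_nonneg _, fun k => ⟨hpR k, ?_⟩⟩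
  have h1 := hW k
  have h2 := hvlow k
  linarith

open ConvexProgram in
/-- The violations of the inexact augmented Lagrangian method approach the element `sb` of
smallest norm, expressed through the squared norms. -/
theorem exists_bound_excess_violations [CompleteSpace Y] {S : Set Y} (hcl : IsClosed S) {N : Y → ℝ}
    (hconv : ConvexOn ℝ S N) {M : ℝ} (hM0 : 0 ≤ M)
    (hM : ∀ s ∈ S, ∀ t ∈ S, N s ≤ N t + M * ‖s - t‖) {sb : Y}
    (hsbS : sb ∈ S) (hsb : ∀ t ∈ S, 0 ≤ inner ℝ sb (t - sb))
    {γ ε : ℕ → ℝ} (hA : StepErrorAssumption γ ε) {l s : ℕ → Y} (hsS : ∀ k, s (k + 1) ∈ S)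
    (happ : ∀ k, ∀ t ∈ S, N (s (k + 1)) - inner ℝ (l k) (s (k + 1)) + γ k / 2 * ‖s (k + 1)‖ ^ 2
      ≤ N t - inner ℝ (l k) t + γ k / 2 * ‖t‖ ^ 2 + ε (k + 1) ^ 2 / (2 * γ k))
    (hl : ∀ k, l (k + 1) = l k - γ k • s (k + 1)) :
    ∃ C : ℝ, ∀ᶠ k in atTop,
      (∑ i ∈ Finset.range (k + 1), γ i) * (‖s (k + 1)‖ ^ 2 - ‖sb‖ ^ 2) ≤ C := by
  obtain ⟨lb, hlb⟩ := exists_subgradient_of_lipschitz hconv hsbS (hM sb hsbS) hM0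
  choose p hpS hp using fun k =>
    exists_proximal_point ⟨sb, hsbS⟩ hcl hconv hM0 hM (l k) (hA.step_pos k)
  have hsp : ∀ k, ‖s (k + 1) - p k‖ ≤ ε (k + 1) / γ k := fun k =>
    norm_sub_proximal_point_le (hA.step_pos k) (hA.err_nonneg k) (hp k _ (hsS k))
      (happ k _ (hpS k))
  have hlp : ∀ k, ‖l k - γ k • p k - l (k + 1)‖ ≤ ε (k + 1) := fun k => by
    have e1 : l k - γ k • p k - l (k + 1) = γ k • (s (k + 1) - p k) := by rw [hl]; module
    rw [e1, norm_smul, Real.norm_of_nonneg (hA.step_pos k).le]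
    have := mul_le_mul_of_nonneg_left (hsp k) (hA.step_pos k).le
    rwa [mul_div_cancel₀ _ (hA.step_pos k).ne'] at this
  obtain ⟨R, C, hR, hRC⟩ := exists_bound_excess_proximal_points hsbS hsb hlb hA hpS hp hlp
  obtain ⟨D, hD0, hD⟩ := hA.A2.exists_nonneg
  have hT1 : ∀ᶠ k in atTop, 1 ≤ ∑ i ∈ Finset.range (k + 1), γ i :=
    (hA.A5.comp (tendsto_add_atTop_nat 1)).eventually_ge_atTop 1
  refine ⟨C + D * (2 * R + D), ?_⟩
  filter_upwards [hD.bound, hT1] with k hk hk1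
  obtain ⟨h1, h2⟩ := hRC k
  set T := ∑ i ∈ Finset.range (k + 1), γ i with hT
  set δ := ε (k + 1) / γ k with hδ
  have hδ0 : 0 ≤ δ := div_nonneg (hA.err_nonneg k) (hA.step_pos k).le
  -- Once `T ≥ 1` the rate in (A2) is at most `1`, so (A2) makes `δ * T` bounded.
  have hδT : δ * T ≤ D := by
    rw [Real.norm_of_nonneg (by positivity), Real.norm_of_nonneg (by positivity)] at hk
    refine hk.trans (mul_le_of_le_one_right hD0 ?_)
    rw [div_le_one (by positivity)]
    exact Real.one_le_sqrt.2 hk1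
  have hδD : δ ≤ D := by nlinarith
  have h3 : ‖s (k + 1)‖ ≤ ‖p k‖ + δ := by
    have := norm_le_norm_add_norm_sub' (s (k + 1)) (p k)
    linarith [hsp k]
  have h4 : ‖s (k + 1)‖ ^ 2 ≤ ‖p k‖ ^ 2 + δ * (2 * R + D) := by
    have := norm_nonneg (s (k + 1))
    nlinarith
  have h5 : T * (δ * (2 * R + D)) ≤ D * (2 * R + D) := by
    rw [← mul_assoc, mul_comm T]
    exact mul_le_mul_of_nonneg_right hδT (by positivity)
  nlinarith

end InexactProximalPoint

/-! ### Value function of the program and its polyhedral structure. -/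

namespace ConvexProgram

variable {H Y : Type*} [NormedAddCommGroup H] [NormedAddCommGroup Y] {P : ConvexProgram H Y}

theorem mem_CC_iff {x : H} {s : Y} : (x, s) ∈ P.CC ↔ x ∈ P.X ∧ P.C x - s ∈ P.K := by
  constructor
  · rintro ⟨hx, y, hy, h⟩
    refine ⟨hx, ?_⟩
    simp only at h
    rwa [h, sub_sub_cancel]
  · rintro ⟨hx, hy⟩
    exact ⟨hx, _, hy, (sub_sub_cancel _ _).symm⟩

theorem value_eq_top {s : Y} (hs : s ∉ P.violations) : P.value s = ⊤ := by
  refine iInf₂_eq_top.2 fun x hx => absurd ⟨x, hx⟩ hs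

theorem value_le {x : H} {s : Y} (h : (x, s) ∈ P.CC) : P.value s ≤ P.f x := iInf₂_le x h

theorem IsIALM.mem_CC [InnerProductSpace ℝ Y] {γ ε : ℕ → ℝ} {x : ℕ → H} {y l s : ℕ → Y} (h : P.IsIALM γ ε x y l s)
    (k : ℕ) : (x (k + 1), s (k + 1)) ∈ P.CC :=
  ⟨h.x_mem k, y (k + 1), h.y_mem k, h.s_eq k⟩

variable [InnerProductSpace ℝ H] [InnerProductSpace ℝ Y]

theorem Standing.f_ne_top (hP : P.Standing) (hf : ELipschitzOn P.f P.X) {x : H} (hx : x ∈ P.X) :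
    P.f x ≠ ⊤ := by
  obtain ⟨L, -, hL⟩ := hf
  obtain ⟨x₀, hx₀, hne⟩ := hP.f_proper
  have h := hL x hx x₀ hx₀
  rw [← EReal.coe_toReal hne (hP.f_ne_bot x₀ hx₀), ← EReal.coe_add] at h
  exact ne_top_of_le_ne_top (EReal.coe_ne_top _) h

theorem Standing.coe_toReal_f (hP : P.Standing) (hf : ELipschitzOn P.f P.X) {x : H}
    (hx : x ∈ P.X) : ((P.f x).toReal : EReal) = P.f x :=
  EReal.coe_toReal (hP.f_ne_top hf hx) (hP.f_ne_bot x hx)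

theorem Standing.exists_lipschitz_toReal_f (hP : P.Standing) (hf : ELipschitzOn P.f P.X) :
    ∃ L : ℝ, 0 ≤ L ∧ ∀ x ∈ P.X, ∀ x' ∈ P.X, (P.f x).toReal ≤ (P.f x').toReal + L * ‖x - x'‖ := by
  have hf' := hf
  obtain ⟨L, hL0, hL⟩ := hf
  refine ⟨L, hL0, fun x hx x' hx' => ?_⟩
  have h := hL x hx x' hx'
  rw [← hP.coe_toReal_f hf' hx, ← hP.coe_toReal_f hf' hx', ← EReal.coe_add] at h
  exact EReal.coe_le_coe_iff.1 h

theorem Standing.value_ne_top (hP : P.Standing) (hf : ELipschitzOn P.f P.X) {s : Y}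
    (hs : s ∈ P.violations) : P.value s ≠ ⊤ := by
  obtain ⟨x, hx⟩ := hs
  exact ne_top_of_le_ne_top (hP.f_ne_top hf hx.1) (value_le hx)

theorem Standing.valueDom_eq (hP : P.Standing) (hf : ELipschitzOn P.f P.X) :
    P.valueDom = P.violations := by
  ext s
  refine ⟨fun h => ?_, fun h => lt_top_iff_ne_top.2 (hP.value_ne_top hf h)⟩
  by_contra hs
  exact (lt_top_iff_ne_top.1 h) (value_eq_top hs)

theorem Standing.coe_toReal_value (hP : P.Standing) (hf : ELipschitzOn P.f P.X) {s : Y}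
    (hs : s ∈ P.violations) : ((P.value s).toReal : EReal) = P.value s :=
  EReal.coe_toReal (hP.value_ne_top hf hs) (hP.value_ne_bot s)

theorem Standing.toReal_value_le (hP : P.Standing) (hf : ELipschitzOn P.f P.X) {x : H} {s : Y}
    (h : (x, s) ∈ P.CC) : (P.value s).toReal ≤ (P.f x).toReal := by
  rw [← EReal.coe_le_coe_iff, hP.coe_toReal_value hf ⟨x, h⟩, hP.coe_toReal_f hf h.1]
  exact value_le h

theorem Standing.exists_toReal_f_lt (hP : P.Standing) (hf : ELipschitzOn P.f P.X) {s : Y}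
    (hs : s ∈ P.violations) {δ : ℝ} (hδ : 0 < δ) :
    ∃ x, (x, s) ∈ P.CC ∧ (P.f x).toReal < (P.value s).toReal + δ := by
  have h : P.value s < (((P.value s).toReal + δ : ℝ) : EReal) := by
    nth_rewrite 1 [← hP.coe_toReal_value hf hs]
    exact EReal.coe_lt_coe_iff.2 (lt_add_of_pos_right _ hδ)
  simp only [value, iInf_lt_iff] at h
  obtain ⟨x, hx, hlt⟩ := h
  rw [← hP.coe_toReal_f hf hx.1] at hlt
  exact ⟨x, hx, EReal.coe_lt_coe_iff.1 hlt⟩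

theorem Standing.convex_violations (hP : P.Standing) : Convex ℝ P.violations := by
  rintro s ⟨x, hx⟩ t ⟨x', hx'⟩ a b ha hb hab
  exact ⟨a • x + b • x', hP.CC_convex hx hx' ha hb hab⟩

theorem Standing.convexOn_toReal_value (hP : P.Standing) (hf : ELipschitzOn P.f P.X) :
    ConvexOn ℝ P.violations fun s => (P.value s).toReal := by
  refine ⟨hP.convex_violations, ?_⟩
  · intro s hs t ht a b ha hb hab
    refine le_of_forall_pos_le_add fun δ hδ => ?_
    obtain ⟨x, hx, hxδ⟩ := hP.exists_toReal_f_lt hf hs hδ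
    obtain ⟨x', hx', hxδ'⟩ := hP.exists_toReal_f_lt hf ht hδ
    have h1 : (a • x + b • x', a • s + b • t) ∈ P.CC := hP.CC_convex hx hx' ha hb hab
    have h2 : (a • x + b • x', a • (P.f x).toReal + b • (P.f x').toReal) ∈ P.epi :=
      hP.f_convex (x := (x, (P.f x).toReal)) (y := (x', (P.f x').toReal))
        ⟨hx.1, (hP.coe_toReal_f hf hx.1).ge⟩ ⟨hx'.1, (hP.coe_toReal_f hf hx'.1).ge⟩ ha hb hab
    have h3 := h2.2
    simp only at h3
    rw [← hP.coe_toReal_f hf h1.1, EReal.coe_le_coe_iff] at h3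
    have h4 := hP.toReal_value_le hf h1
    have h5 := mul_le_mul_of_nonneg_left hxδ.le ha
    have h6 := mul_le_mul_of_nonneg_left hxδ'.le hb
    have h7 : a * δ + b * δ = δ := by rw [← add_mul, hab, one_mul]
    simp only [smul_eq_mul] at h3 ⊢
    linarith

/-- For polyhedral data, the graph of `C - K` is a finite union of polyhedral relations. -/
theorem exists_CC_eq_iUnion [CompleteSpace H] [CompleteSpace Y]
    (hC : IsPolyhedralMapOn P.C P.X) (hK : IsPolyhedralSet P.K) (hX : IsPolyhedralSet P.X) :
    ∃ (n : ℕ) (Q : Fin n → Set (H × Y)), (∀ i, IsPolyhedralRel (Q i)) ∧ P.CC = ⋃ i, Q i := by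
  obtain ⟨n, R, A, hcov, hR, hA⟩ := hC
  obtain ⟨mK, aK, cK, hK⟩ := hK
  obtain ⟨mX, aX, cX, hX⟩ := hX
  refine ⟨n, fun i => {p | (p.1 ∈ P.X ∧ p.1 ∈ R i) ∧ A i p.1 - p.2 ∈ P.K}, fun i => ?_, ?_⟩
  · obtain ⟨mR, aR, cR, hR⟩ := hR i
    have key := IsPolyhedralRel.of_fintype (ι := (Fin mX ⊕ Fin mR) ⊕ Fin mK) (H := H) (Y := Y)
      -- The constraints on `A i x - s` from `K` pass to `x` through the adjoint of the linear part;
      -- the constant part `A i 0` moves to the right-hand side.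
      (Sum.elim (Sum.elim aX aR) fun j => (A i).contLinear.adjoint (aK j))
      (Sum.elim (Sum.elim 0 0) fun j => -aK j)
      (Sum.elim (Sum.elim cX cR) fun j => cK j - inner ℝ (aK j) (A i 0))
    convert key using 1
    ext ⟨x, s⟩
    have hdec : A i x = (A i).contLinear x + A i 0 := by
      rw [(A i).decomp]; simp
    simp only [hX, hR, hK, hdec, Set.mem_ofPred_eq, Sum.forall, Sum.elim_inl, Sum.elim_inr,
      Pi.zero_apply, inner_zero_left, add_zero, ContinuousLinearMap.adjoint_inner_left,
      inner_neg_left, inner_sub_right, inner_add_right]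
    refine and_congr_right fun _ => forall_congr' fun j => ?_
    constructor <;> intro h <;> linarith
  · ext ⟨x, s⟩
    rw [mem_CC_iff, Set.mem_iUnion]
    constructor
    · rintro ⟨hx, hs⟩
      obtain ⟨i, hi⟩ := Set.mem_iUnion.1 (hcov hx)
      exact ⟨i, ⟨hx, hi⟩, by rwa [← hA i x ⟨hx, hi⟩]⟩
    · rintro ⟨i, ⟨hx, hi⟩, hs⟩
      exact ⟨hx, by rwa [hA i x ⟨hx, hi⟩]⟩

theorem isClosed_violations_of_polyhedral [CompleteSpace H] [CompleteSpace Y]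
    (hC : IsPolyhedralMapOn P.C P.X) (hK : IsPolyhedralSet P.K) (hX : IsPolyhedralSet P.X) :
    IsClosed P.violations := by
  obtain ⟨n, Q, hQ, hCC⟩ := exists_CC_eq_iUnion hC hK hX
  have : P.violations = ⋃ i, {s | ∃ x, (x, s) ∈ Q i} := by
    ext s
    simp only [violations, hCC, Set.mem_iUnion, Set.mem_ofPred_eq]
    exact exists_comm
  rw [this]
  exact isClosed_iUnion_of_finite fun i => (hQ i).isClosed_dom

theorem Standing.exists_lipschitz_toReal_value [CompleteSpace H] [CompleteSpace Y]
    (hP : P.Standing) (hC : IsPolyhedralMapOn P.C P.X) (hK : IsPolyhedralSet P.K)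
    (hX : IsPolyhedralSet P.X) (hf : ELipschitzOn P.f P.X) :
    ∃ M : ℝ, 0 ≤ M ∧ ∀ s ∈ P.violations, ∀ t ∈ P.violations,
      (P.value s).toReal ≤ (P.value t).toReal + M * ‖s - t‖ := by
  obtain ⟨n, Q, hQ, hCC⟩ := exists_CC_eq_iUnion hC hK hX
  obtain ⟨L, hL0, hL⟩ := hP.exists_lipschitz_toReal_f hf
  have hQC : ∀ i, Q i ⊆ P.CC := fun i => hCC ▸ Set.subset_iUnion Q i
  refine exists_lipschitz_marginal hQ (F := fun x => (P.f x).toReal) hL0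
    (fun i j p hp q hq => hL _ (hQC i hp).1 _ (hQC j hq).1)
    (fun i x s h => hP.toReal_value_le hf (hQC i h)) (fun s hs δ hδ => ?_)
    (hP.convexOn_toReal_value hf)
  obtain ⟨x, hx, hlt⟩ := hP.exists_toReal_f_lt hf hs hδ
  rw [hCC] at hx
  obtain ⟨i, hi⟩ := Set.mem_iUnion.1 hx
  exact ⟨i, x, hi, hlt⟩

theorem Standing.violations_nonempty (hP : P.Standing) : P.violations.Nonempty := by
  obtain ⟨x, hx⟩ := hP.X_nonempty
  obtain ⟨y, hy⟩ := hP.K_nonempty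
  exact ⟨P.C x - y, x, hx, y, hy, rfl⟩

theorem Standing.isNearestPoint_sBar [CompleteSpace Y] (hP : P.Standing)
    (hcl : IsClosed P.violations) : IsNearestPoint P.violations 0 P.sBar := by
  have := isNearestPoint_proj hP.violations_nonempty hcl hP.convex_violations 0
  rwa [sBar, hcl.closure_eq]

theorem Standing.inner_sBar_nonneg [CompleteSpace Y] (hP : P.Standing)
    (hcl : IsClosed P.violations) : ∀ t ∈ P.violations, 0 ≤ inner ℝ P.sBar (t - P.sBar) := by
  intro t ht
  have := (hP.isNearestPoint_sBar hcl).inner_le_zero hP.convex_violations t ht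
  rwa [zero_sub, inner_neg_left, neg_nonpos] at this

/-- The violation left after projecting `C x` onto `K` is attainable, so its norm is at least
`‖sBar‖`; the obtuse angle at the projection does the rest. -/
theorem Standing.sq_norm_slack_le [CompleteSpace Y] (hP : P.Standing)
    (hcl : IsClosed P.violations) {x : H} {y : Y} (hx : x ∈ P.X) (hy : y ∈ P.K) :
    ‖y - proj P.K (P.C x)‖ ^ 2 ≤ ‖P.C x - y‖ ^ 2 - ‖P.sBar‖ ^ 2 := by
  have hp := isNearestPoint_proj hP.K_nonempty hP.K_closed hP.K_convex (P.C x)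
  set p := proj P.K (P.C x)
  have h1 := hp.inner_le_zero hP.K_convex y hy
  have h2 := (hP.isNearestPoint_sBar hcl).2 (P.C x - p) ⟨x, hx, p, hp.1, rfl⟩
  rw [zero_sub, zero_sub, norm_neg, norm_neg] at h2
  have h3 := pow_le_pow_left₀ (norm_nonneg _) h2 2
  have h4 : ‖P.C x - y‖ ^ 2 = ‖P.C x - p‖ ^ 2 - 2 * inner ℝ (P.C x - p) (y - p) + ‖y - p‖ ^ 2 := by
    rw [← norm_sub_sq_real, sub_sub_sub_cancel_right]
  linarith

/-! ### Convergence rates of the augmented Lagrangian method. -/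

theorem Standing.augLagrangian_eq (hP : P.Standing) (hf : ELipschitzOn P.f P.X) {x : H} {s : Y}
    (h : (x, s) ∈ P.CC) (g : ℝ) (l : Y) : P.augLagrangian g x s l
      = (((P.f x).toReal + (-inner ℝ l s + g / 2 * ‖s‖ ^ 2) : ℝ) : EReal) := by
  rw [augLagrangian, if_pos h, add_zero, EReal.coe_add (P.f x).toReal,
    hP.coe_toReal_f hf (x := x) h.1]

/-- The approximate minimality condition in terms of the value function. -/
theorem IsIALM.toReal_f_le {γ ε : ℕ → ℝ} {x : ℕ → H} {y l s : ℕ → Y} (h : P.IsIALM γ ε x y l s)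
    (hP : P.Standing) (hf : ELipschitzOn P.f P.X) (k : ℕ) {t : Y} (ht : t ∈ P.violations) :
    (P.f (x (k + 1))).toReal - inner ℝ (l k) (s (k + 1)) + γ k / 2 * ‖s (k + 1)‖ ^ 2
      ≤ (P.value t).toReal - inner ℝ (l k) t + γ k / 2 * ‖t‖ ^ 2 + ε (k + 1) ^ 2 / (2 * γ k) := by
  refine le_of_forall_pos_le_add fun δ hδ => ?_
  obtain ⟨z, hz, hzδ⟩ := hP.exists_toReal_f_lt hf ht hδ
  have h1 := (h.approx_min k).trans (add_le_add_left
    (iInf₂_le (f := fun (p : H × Y) (_ : p ∈ P.CC) => P.augLagrangian (γ k) p.1 p.2 (l k))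
      (z, t) hz) _)
  rw [hP.augLagrangian_eq hf (h.mem_CC k), hP.augLagrangian_eq hf hz, ← EReal.coe_add,
    EReal.coe_le_coe_iff] at h1
  linarith

theorem eventually_of_eventually_succ {p : ℕ → Prop} (h : ∀ᶠ k in atTop, p (k + 1)) :
    ∀ᶠ k in atTop, p k := by
  rw [← map_add_atTop_eq_nat 1]
  exact h

theorem tendsto_rate {γ : ℕ → ℝ} (h : Tendsto (fun k => ∑ i ∈ Finset.range k, γ i) atTop atTop) :
    Tendsto (rate γ) atTop (𝓝 0) := by
  have := (Real.tendsto_sqrt_atTop.comp h).inv_tendsto_atTop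
  refine this.congr fun k => ?_
  simp [rate]

theorem isBigO_rate_of_sq_le {γ u : ℕ → ℝ} {C : ℝ}
    (hT : Tendsto (fun k => ∑ i ∈ Finset.range k, γ i) atTop atTop)
    (h : ∀ᶠ k in atTop, (∑ i ∈ Finset.range k, γ i) * u k ^ 2 ≤ C) : u =O[atTop] rate γ := by
  refine IsBigO.of_bound (√C) ?_
  filter_upwards [h, hT.eventually_gt_atTop 0] with k hk hk0
  have hr : 0 ≤ 1 / √(∑ i ∈ Finset.range k, γ i) := by positivity
  rw [rate, Real.norm_of_nonneg hr, mul_one_div, Real.norm_eq_abs, ← Real.sqrt_sq_eq_abs,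
    ← Real.sqrt_div' _ hk0.le]
  refine Real.sqrt_le_sqrt ?_
  rwa [le_div_iff₀' hk0]

/-- The tolerance in the subproblems decays at least at the rate of the method. -/
theorem StepErrorAssumption.isBigO_tolerance {γ ε : ℕ → ℝ} (hA : StepErrorAssumption γ ε) :
    (fun k => ε (k + 1) ^ 2 / (2 * γ k)) =O[atTop] fun k => rate γ (k + 1) := by
  obtain ⟨D, hD0, hD⟩ := hA.A2.exists_nonneg
  have hT1 : ∀ᶠ k in atTop, 1 ≤ ∑ i ∈ Finset.range (k + 1), γ i :=
    (hA.A5.comp (tendsto_add_atTop_nat 1)).eventually_ge_atTop 1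
  have hε : Tendsto (fun k => ε (k + 1)) atTop (𝓝 0) := hA.A1.tendsto_atTop_zero
  refine IsBigO.of_bound D ?_
  filter_upwards [hD.bound, hT1, hε.eventually_le_const one_pos] with k hk hk1 hk2
  have hγ := hA.step_pos k
  have hε0 := hA.err_nonneg k
  have h1 : (0 : ℝ) ≤ ε (k + 1) / γ k := by positivity
  rw [Real.norm_of_nonneg (by positivity)] at hk ⊢
  refine le_trans ?_ hk
  -- Eventually `ε (k + 1) / 2 ≤ 1 ≤ T`, so the left side of (A2) dominates.
  calc ε (k + 1) ^ 2 / (2 * γ k) = ε (k + 1) / γ k * (ε (k + 1) / 2) := by field_simp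
    _ ≤ _ := by gcongr; linarith

/-- Convergence of the inexact augmented Lagrangian method when the attainable violations are
closed and the value function is Lipschitz continuous on its domain. -/
theorem IsIALM.quantitativelyConverges [CompleteSpace Y] (hP : P.Standing)
    (hf : ELipschitzOn P.f P.X) (hcl : IsClosed P.violations) {M : ℝ} (hM0 : 0 ≤ M)
    (hM : ∀ s ∈ P.violations, ∀ t ∈ P.violations,
      (P.value s).toReal ≤ (P.value t).toReal + M * ‖s - t‖)
    {γ ε : ℕ → ℝ} {x : ℕ → H} {y l s : ℕ → Y} (hA : StepErrorAssumption γ ε)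
    (h : P.IsIALM γ ε x y l s) : P.QuantitativelyConverges γ x y := by
  have hsbS := (hP.isNearestPoint_sBar hcl).1
  have hsb := hP.inner_sBar_nonneg hcl
  have hsS : ∀ k, s (k + 1) ∈ P.violations := fun k => ⟨_, h.mem_CC k⟩
  have hle : ∀ k, (P.value (s (k + 1))).toReal ≤ (P.f (x (k + 1))).toReal := fun k =>
    hP.toReal_value_le hf (h.mem_CC k)
  obtain ⟨C, hC⟩ := exists_bound_excess_violations hcl (hP.convexOn_toReal_value hf) hM0 hM hsbS hsb
    hA hsS (fun k t ht => by
      have h1 := h.toReal_f_le hP hf k ht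
      have h2 := hle k
      linarith) h.l_succ
  have hT0 : ∀ k, 0 ≤ ∑ i ∈ Finset.range k, γ i := fun k =>
    Finset.sum_nonneg fun i _ => (hA.step_pos i).le
  have hviol : (fun k => ‖P.C (x k) - y k - P.sBar‖) =O[atTop] rate γ := by
    refine isBigO_rate_of_sq_le (C := C) hA.A5 (eventually_of_eventually_succ ?_)
    filter_upwards [hC] with k hk
    refine le_trans (mul_le_mul_of_nonneg_left ?_ (hT0 _)) hk
    -- The variational inequality for `sBar` bounds `‖s - sBar‖ ^ 2` by the excess `‖s‖ ^ 2 - ‖sBar‖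
    -- ^ 2`.
    have h1 := hsb _ (hsS k)
    rw [← h.s_eq k, norm_sub_sq_real, real_inner_comm]
    rw [inner_sub_right, real_inner_self_eq_norm_sq] at h1
    linarith
  have hslack : (fun k => ‖y k - proj P.K (P.C (x k))‖) =O[atTop] rate γ := by
    refine isBigO_rate_of_sq_le (C := C) hA.A5 (eventually_of_eventually_succ ?_)
    filter_upwards [hC] with k hk
    refine le_trans (mul_le_mul_of_nonneg_left ?_ (hT0 _)) hk
    have h1 := hP.sq_norm_slack_le hcl (h.x_mem k) (h.y_mem k)
    rwa [← h.s_eq k] at h1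
  have hval : (fun k => (P.f (x k)).toReal - (P.value P.sBar).toReal) =O[atTop] rate γ := by
    have h1 : (fun k => ε (k - 1 + 1) ^ 2 / (2 * γ (k - 1))) =O[atTop] rate γ := by
      obtain ⟨D, hD⟩ := hA.isBigO_tolerance.bound
      exact IsBigO.of_bound D (eventually_of_eventually_succ hD)
    refine IsBigO.trans (IsBigO.of_bound 1 (eventually_of_eventually_succ
      (Eventually.of_forall fun k => ?_))) (h1.add (hviol.const_mul_left M))
    -- Testing with the iterate's own violation cancels the multiplier and penalty terms, leaving
    -- only the tolerance.
    have h2 := h.toReal_f_le hP hf k (hsS k)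
    have h3 := hM _ (hsS k) _ hsbS
    have h4 := hM _ hsbS _ (hsS k)
    have h5 := hle k
    have h6 : 0 ≤ ε (k + 1) ^ 2 / (2 * γ k) := by have := hA.step_pos k; positivity
    rw [norm_sub_rev] at h4
    simp only [Nat.add_sub_cancel]
    have h7 : 0 ≤ ε (k + 1) ^ 2 / (2 * γ k) + M * ‖s (k + 1) - P.sBar‖ := by positivity
    rw [← h.s_eq k, one_mul, Real.norm_of_nonneg h7, Real.norm_eq_abs, abs_le]
    constructor <;> linarith
  have hr := tendsto_rate hA.A5
  refine ⟨⟨⟨?_, ?_, hslack.trans_tendsto hr⟩, hviol, hslack⟩, hP.value_ne_top hf hsbS,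
    hP.value_ne_bot _, hval.abs_left⟩
  · have h1 : Tendsto (fun k => (P.f (x k)).toReal) atTop (𝓝 (P.value P.sBar).toReal) :=
      tendsto_sub_nhds_zero_iff.1 (hval.trans_tendsto hr)
    have h2 := (continuous_coe_real_ereal.tendsto _).comp h1
    rw [hP.coe_toReal_value hf hsbS] at h2
    -- Index `0` must be dropped: `x 0` is not constrained to lie in `X`.
    refine h2.congr' (eventually_of_eventually_succ (Eventually.of_forall fun k => ?_))
    exact hP.coe_toReal_f hf (h.x_mem k)
  · exact tendsto_iff_norm_sub_tendsto_zero.2 (hviol.trans_tendsto hr)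

theorem Standing.valueSubdifferentiableAt_sBar [CompleteSpace Y] (hP : P.Standing)
    (hf : ELipschitzOn P.f P.X) (hcl : IsClosed P.violations) {M : ℝ} (hM0 : 0 ≤ M)
    (hM : ∀ s ∈ P.violations, ∀ t ∈ P.violations,
      (P.value s).toReal ≤ (P.value t).toReal + M * ‖s - t‖) :
    P.ValueSubdifferentiableAt P.sBar := by
  have hsbS := (hP.isNearestPoint_sBar hcl).1
  obtain ⟨l, hl⟩ := exists_subgradient_of_lipschitz (hP.convexOn_toReal_value hf) hsbS
    (hM _ hsbS) hM0
  refine ⟨hP.value_ne_top hf hsbS, hP.value_ne_bot _, l, fun t => ?_⟩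
  by_cases ht : t ∈ P.violations
  · rw [← hP.coe_toReal_value hf hsbS, ← hP.coe_toReal_value hf ht, ← EReal.coe_add,
      EReal.coe_le_coe_iff]
    exact hl t ht
  · rw [value_eq_top ht]
    exact le_top

end ConvexProgram

theorem mainTheorem9 {H Y : Type*}
    [NormedAddCommGroup H] [InnerProductSpace ℝ H] [CompleteSpace H]
    [NormedAddCommGroup Y] [InnerProductSpace ℝ Y] [CompleteSpace Y]
    (P : ConvexProgram H Y) (hP : P.Standing)
    (hC : IsPolyhedralMapOn P.C P.X) (hK : IsPolyhedralSet P.K) (hX : IsPolyhedralSet P.X)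
    (hf : ELipschitzOn P.f P.X) :
    ELipschitzOn P.value P.valueDom ∧
    P.ValueSubdifferentiableAt P.sBar ∧
    ∀ (γ ε : ℕ → ℝ) (x : ℕ → H) (y l s : ℕ → Y),
      ConvexProgram.StepErrorAssumption γ ε → P.IsIALM γ ε x y l s →
        P.QuantitativelyConverges γ x y := by
  have hcl := ConvexProgram.isClosed_violations_of_polyhedral hC hK hX
  obtain ⟨M, hM0, hM⟩ := hP.exists_lipschitz_toReal_value hC hK hX hf
  refine ⟨⟨M, hM0, fun s hs t ht => ?_⟩, hP.valueSubdifferentiableAt_sBar hf hcl hM0 hM,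
    fun γ ε x y l s hA h => h.quantitativelyConverges hP hf hcl hM0 hM hA⟩
  rw [hP.valueDom_eq hf] at hs ht
  rw [← hP.coe_toReal_value hf hs, ← hP.coe_toReal_value hf ht, ← EReal.coe_add,
    EReal.coe_le_coe_iff]
  exact hM s hs t ht
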